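/- Let $\Omega=\{\rho<0\}\subset\mathbb C^n$ be a bounded convex domain with smooth boundary, where $\rho:\mathbb C^n\to\mathbb R$ is $C^\infty$ and $\nabla\rho\neq0$ on $\partial\Omega$. For a smooth map $f$ defined near $0\in\mathbb C$, let $v_0(f)\in\mathbb N\cup\{\infty\}$ be its vanishing order at $0$, the least order of a nonzero real derivative of $f$ at $0$. Assume that $\Omega$ is of finite type: for every $p\in\partial\Omega$, $$\sup\left\{\frac{v_0(\rho\circ\varphi)}{v_0(\varphi-p)}:\ \varphi:\mathbb D\to\mathbb C^n\text{ holomorphic and nonconstant},\ \varphi(0)=p\right\}<\infty .$$ Let $P\in\partial\Omega$, let $\nu=\nabla\rho(P)/\|\nabla\rho(P)\|$ be the unit outward normal at $P$, and let $P_\delta=P-\delta\nu$. For $Q\in\Omega$ and $\xi\in\mathbb C^n$ let $F(Q,\xi)$ be any one of the following three metrics of $\Omega$ (which in fact coincide on convex domains, by a theorem of Lempert): - the Kobayashi metric $F_K(Q,\xi)=\inf\{\alpha>0:\exists\,\varphi:\mathbb D\to\Omega \text{ holomorphic},\ \varphi(0)=Q,\ \varphi'(0)=\xi/\alpha\}$;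 - the Sibony metric $F_S(Q,\xi)=\sup_u\Big(\sum_{i,j}\frac{\partial^2u}{\partial z_i\partial\bar z_j}(Q)\,\xi_i\bar\xi_j\Big)^{1/2}$, over all $u$ with $0\le u\le1$ on $\Omega$, $u(Q)=0$, $u$ of class $C^2$ near $Q$, and $\log u$ plurisubharmonic on $\Omega$ (the function $-\infty$ being allowed); - the Carathéodory metric $F_C(Q,\xi)=\sup\Big\{\Big|\sum_i\frac{\partial f}{\partial z_i}(Q)\xi_i\Big| : f:\Omega\to\mathbb D\text{ holomorphic},\ f(Q)=0\Big\}$. Then $P_\delta\in\Omega$ for all sufficiently small $\delta>0$, and the following hold. (a) For every nonzero $\xi$ in the complex tangent space $T_P(\partial\Omega)\cap i\,T_P(\partial\Omega)$, the order of tangency $m=\Delta(\partial\Omega,P,\xi):=v_0\big(z\mapsto\rho(P+z\xi)\big)$ is finite, and there are constants $c,C>0$, independent of $\delta$, such that $$c\,\frac{|\xi|}{\delta^{1/m}}\le F(P_\delta,\xi)\le C\,\frac{|\xi|}{\delta^{1/m}}\qquad\text{for all sufficiently small }\delta>0 .$$ (b) There are constants $c',C'>0$, independent of $\delta$, such that $$\frac{c'}{\delta}\le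 F(P_\delta,\nu)\le\frac{C'}{\delta}\qquad\text{for all sufficiently small }\delta>0 .$$ -/

import Mathlib

open Set Filter Topology MeasureTheory
open scoped ENNReal ContDiff

noncomputable section

namespace InvMetric

/-- Complex `n`-space `ℂⁿ` with its Hermitian norm. -/
abbrev Cn (n : ℕ) : Type := EuclideanSpace ℂ (Fin n)

/-! ### Domains and their boundaries -/

/-- `Ω = {ρ < 0}` is a bounded domain with smooth boundary and `ρ` is a smooth defining function
of it, with gradient nowhere zero on the boundary. -/
structure IsSmoothlyBounded {n : ℕ} (Ω : Set (Cn n)) (ρ : Cn n → ℝ) : Prop where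
  bounded : Bornology.IsBounded Ω
  smooth : ContDiff ℝ ∞ ρ
  eq_sublevel : Ω = {z | ρ z < 0}
  gradient_ne_zero : ∀ p ∈ frontier Ω, gradient ρ p ≠ 0

/-- The unit outward normal `ν = ∇ρ(P) / ‖∇ρ(P)‖`. -/
def unitNormal {n : ℕ} (ρ : Cn n → ℝ) (P : Cn n) : Cn n :=
  ‖gradient ρ P‖⁻¹ • gradient ρ P

/-- The complex tangent space `T_P(∂Ω) ∩ J T_P(∂Ω)` of `∂Ω = {ρ = 0}` at `P`: the vectors `ξ` for
which both `ξ` and `J ξ = i ξ` are annihilated by the real differential of `ρ` at `P`. -/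
def complexTangentSpace {n : ℕ} (ρ : Cn n → ℝ) (P : Cn n) : Set (Cn n) :=
  {ξ | fderiv ℝ ρ P ξ = 0 ∧ fderiv ℝ ρ P (Complex.I • ξ) = 0}

/-- The vanishing order `v₀(f)` at `0` of a smooth map `f` of one complex variable: the least order
of a nonzero real derivative at `0`, and `⊤` if all derivatives vanish. -/
def vanishingOrder {V : Type*} [NormedAddCommGroup V] [NormedSpace ℝ V] (f : ℂ → V) : ℕ∞ :=
  ⨅ (k : ℕ) (_ : iteratedFDeriv ℝ k f 0 ≠ 0), (k : ℕ∞)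

/-- The order of tangency `Δ(∂Ω, P, ξ) = v₀(z ↦ ρ(P + z ξ))` of `∂Ω` at `P` in direction `ξ`. -/
def tangencyOrder {n : ℕ} (ρ : Cn n → ℝ) (P ξ : Cn n) : ℕ∞ :=
  vanishingOrder (fun z : ℂ => ρ (P + z • ξ))

/-- Finite type at `P`: `v₀(ρ ∘ φ) / v₀(φ - P)` is bounded over all nonconstant holomorphic
discs `φ : 𝔻 → ℂⁿ` with `φ(0) = P`. -/
def IsFiniteTypeAt {n : ℕ} (ρ : Cn n → ℝ) (P : Cn n) : Prop :=
  ∃ C : ℕ, ∀ φ : ℂ → Cn n, DifferentiableOn ℂ φ (Metric.ball 0 1) → φ 0 = P →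
    vanishingOrder (fun z => φ z - P) ≠ ⊤ →
      vanishingOrder (fun z => ρ (φ z)) ≤ C * vanishingOrder (fun z => φ z - P)

/-- `Ω` is of finite type: every boundary point is of finite type. -/
def IsFiniteType {n : ℕ} (Ω : Set (Cn n)) (ρ : Cn n → ℝ) : Prop :=
  ∀ p ∈ frontier Ω, IsFiniteTypeAt ρ p

/-! ### Plurisubharmonic functions and the complex Hessian -/

/-- The mean over the unit circle of an extended real valued function `g`, as the mean of its
positive part minus the mean of its negative part. -/
def circleMean (g : ℂ → EReal) : EReal :=
  (((∫⁻ θ in Ioc (0 : ℝ) (2 * Real.pi), (g (Complex.exp (θ * Complex.I))).toENNReal)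
      / ENNReal.ofReal (2 * Real.pi) : ℝ≥0∞) : EReal)
  - (((∫⁻ θ in Ioc (0 : ℝ) (2 * Real.pi), (-g (Complex.exp (θ * Complex.I))).toENNReal)
      / ENNReal.ofReal (2 * Real.pi) : ℝ≥0∞) : EReal)

/-- `v : Ω → [-∞, ∞)` is plurisubharmonic: upper semicontinuous and with the sub-mean value
property on every closed complex disc `{a + z b : |z| ≤ 1}` in `Ω`. -/
structure IsPlurisubharmonicOn {n : ℕ} (v : Cn n → EReal) (Ω : Set (Cn n)) : Prop where
  usc : UpperSemicontinuousOn v Ω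
  ne_top : ∀ z ∈ Ω, v z ≠ ⊤
  le_circleMean : ∀ a b : Cn n, (∀ z ∈ Metric.closedBall (0 : ℂ) 1, a + z • b ∈ Ω) →
    v a ≤ circleMean (fun z => v (a + z • b))

/-- The Wirtinger derivative `∂f/∂z_j = (∂f/∂x_j - i ∂f/∂y_j) / 2`. -/
def dz {n : ℕ} (j : Fin n) (f : Cn n → ℂ) (z : Cn n) : ℂ :=
  (fderiv ℝ f z (EuclideanSpace.single j 1)
    - Complex.I * fderiv ℝ f z (EuclideanSpace.single j Complex.I)) / 2

/-- The Wirtinger derivative `∂f/∂z̄_j = (∂f/∂x_j + i ∂f/∂y_j) / 2`. -/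
def dzbar {n : ℕ} (j : Fin n) (f : Cn n → ℂ) (z : Cn n) : ℂ :=
  (fderiv ℝ f z (EuclideanSpace.single j 1)
    + Complex.I * fderiv ℝ f z (EuclideanSpace.single j Complex.I)) / 2

/-- The complex Hessian form `∑ (∂²u/∂z_i ∂z̄_j)(P) ξ_i ξ̄_j` (a real number for real `u` of
class `C²` near `P`). -/
def complexHessian {n : ℕ} (u : Cn n → ℝ) (P ξ : Cn n) : ℝ :=
  (∑ i, ∑ j, dz i (dzbar j (fun z => (u z : ℂ))) P * ξ i * starRingEnd ℂ (ξ j)).re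

/-! ### The invariant metrics -/

/-- The Kobayashi metric: the infimum of the `α > 0` for which there is a holomorphic
`φ : 𝔻 → Ω` with `φ(0) = P` and `φ'(0) = ξ / α`. -/
def kobayashi {n : ℕ} (Ω : Set (Cn n)) (P ξ : Cn n) : ℝ≥0∞ :=
  ⨅ (α : ℝ) (_ : 0 < α ∧ ∃ φ : ℂ → Cn n, DifferentiableOn ℂ φ (Metric.ball 0 1) ∧
    MapsTo φ (Metric.ball 0 1) Ω ∧ φ 0 = P ∧ deriv φ 0 = α⁻¹ • ξ), ENNReal.ofReal α

/-- The Carathéodory metric: the supremum of `|f_*(P) ξ|` over the holomorphic `f : Ω → 𝔻` with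
`f(P) = 0`. -/
def caratheodory {n : ℕ} (Ω : Set (Cn n)) (P ξ : Cn n) : ℝ≥0∞ :=
  ⨆ (f : Cn n → ℂ) (_ : DifferentiableOn ℂ f Ω ∧ MapsTo f Ω (Metric.ball 0 1) ∧ f P = 0),
    ENNReal.ofReal ‖fderiv ℂ f P ξ‖

/-- The class `A_Ω(P)` of candidate functions for the Sibony metric. The function `log u` takes
the value `-∞` at the zeros of `u`. -/
structure IsSibonyCandidate {n : ℕ} (Ω : Set (Cn n)) (P : Cn n) (u : Cn n → ℝ) : Prop where
  contDiffAt : ContDiffAt ℝ 2 u P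
  eq_zero : u P = 0
  mem_Icc : ∀ z ∈ Ω, u z ∈ Icc (0 : ℝ) 1
  log_psh : IsPlurisubharmonicOn (fun z => ENNReal.log (ENNReal.ofReal (u z))) Ω

/-- The Sibony metric: the supremum over `u ∈ A_Ω(P)` of the square root of the complex Hessian
of `u` at `P` in direction `ξ`. -/
def sibony {n : ℕ} (Ω : Set (Cn n)) (P ξ : Cn n) : ℝ≥0∞ :=
  ⨆ (u : Cn n → ℝ) (_ : IsSibonyCandidate Ω P u), ENNReal.ofReal (Real.sqrt (complexHessian u P ξ))

end InvMetric

end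

/-! The metrics of `Ω` at `Q` in direction `ξ` are controlled by the one-dimensional slice
`{z : Q + z ξ ∈ Ω}`.

If the slice contains the disc of radius `r` about `0`, then all three metrics are at most `1 / r`.
For the Kobayashi metric the affine disc is a competitor, and the Carathéodory metric is smaller by
the Schwarz lemma (`caratheodory_le_kobayashi`). For a Sibony candidate `u`, the restriction
`U z = u (Q + z r ξ)` satisfies `U ≤ 1`, has `log U` subharmonic and vanishes to second order at `0`,
so `U z ≤ |z|²` by the maximum principle (`le_norm_sq_of_log_subharmonic`), and the complex Hessian,
being half the average of the second derivatives in the directions `ξ` and `i ξ`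
(`complexHessian_eq`), is at most `1 / r²`.

If `Ω` is convex and `Q + z ξ ∉ Ω`, then all three metrics are at least `1 / (2 |z|)`: a complex
functional separating this point from `Ω` maps `Ω` to a half plane, and a Cayley transform maps the
half plane to the disc (`exists_holomorphic_of_notMem`). The resulting `f` bounds the Carathéodory
metric, hence the Kobayashi metric, and `|f|²` is a Sibony candidate by Jensen's formula.

It remains to see that at `Q = P - δ ν` both radii are comparable with `δ ^ (1 / m)`. Moving by
`- δ ν` lowers `ρ` by an amount comparable with `δ`, so it suffices that `ρ (P + z ξ) = O(|z| ^ m)`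
and that `ρ (P + z ξ) ≥ a |z| ^ m` along one ray. The former is Taylor's formula. For the latter, the
`m`-th derivative of `z ↦ ρ (P + z ξ)` is nonzero on some diagonal vector by polarization, and since
`P + ℂ ξ` lies in the tangent hyperplane, which does not meet the convex set `Ω`, its value there is
positive (`IsSmoothlyBounded.exists_growth`). In the normal direction the same argument applies with
`m = 1`. Finite type, tested on the affine disc `z ↦ P + z ξ`, makes `m` finite. -/

/-! ### Iterated derivatives of smooth maps -/

section IteratedDerivatives

universe u
variable {E F : Type u} [NormedAddCommGroup E] [NormedSpace ℝ E] [NormedAddCommGroup F]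
  [NormedSpace ℝ F]

/-- Iterated derivatives of smooth maps are symmetric. The permutations are generated by swaps of
adjacent arguments; the swap of the first two is the symmetry of the second derivative, and the
others are handled by induction, being swaps of arguments of a lower derivative. -/
theorem ContDiff.iteratedFDeriv_comp_perm_of_smooth {f : E → F} (hf : ContDiff ℝ ∞ f) (n : ℕ)
    (x : E) (v : Fin n → E) (σ : Equiv.Perm (Fin n)) :
    iteratedFDeriv ℝ n f x (v ∘ σ) = iteratedFDeriv ℝ n f x v := by
  have hdiff : ∀ k, ContDiff ℝ ∞ (iteratedFDeriv ℝ k f) := fun k =>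
    hf.iteratedFDeriv_right (by norm_cast)
  induction n generalizing x with
  | zero => rw [Subsingleton.elim σ 1]; rfl
  | succ n ih =>
    have hσ : σ ∈ Submonoid.closure
        (Set.range fun i : Fin n => Equiv.swap i.castSucc i.succ) := by
      rw [Equiv.Perm.mclosure_swap_castSucc_succ]; trivial
    induction hσ using Submonoid.closure_induction generalizing v with
    | one => rfl
    | mul σ τ _ _ h₁ h₂ =>
      rw [Equiv.Perm.coe_mul, ← Function.comp_assoc, h₂, h₁]
    | mem σ h =>
      obtain ⟨i, rfl⟩ := h
      rw [iteratedFDeriv_succ_apply_left, iteratedFDeriv_succ_apply_left]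
      cases n with
      | zero => exact i.elim0
      | succ n =>
        induction i using Fin.cases with
        | zero =>
          have key : ∀ (a : E) (w : Fin (n + 1) → E),
              (fderiv ℝ (iteratedFDeriv ℝ (n + 1) f) x a) w
                = fderiv ℝ (fderiv ℝ (iteratedFDeriv ℝ n f)) x a (w 0) (Fin.tail w) := by
            intro a w
            have hd : DifferentiableAt ℝ (fderiv ℝ (iteratedFDeriv ℝ n f)) x :=
              ((hdiff n).fderiv_right (m := ∞) (by norm_cast)).differentiable (by simp) x
            rw [← fderiv_continuousMultilinear_apply_const_apply
              ((hdiff (n + 1)).differentiable (by simp) x)]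
            change fderiv ℝ (fun y => (fderiv ℝ (iteratedFDeriv ℝ n f) y (w 0)) (Fin.tail w)) x a = _
            rw [fderiv_continuousMultilinear_apply_const_apply
              (hd.clm_apply (differentiableAt_const _)),
              fderiv_clm_apply hd (differentiableAt_const _)]
            simp
          rw [key, key]
          have hsymm := (hdiff n).contDiffAt (x := x) |>.isSymmSndFDerivAt
            (by simp only [minSmoothness_of_isRCLikeNormedField]; norm_cast)
          have htail : Fin.tail (Fin.tail (v ∘ Equiv.swap (0 : Fin (n + 1)).castSucc
              (Fin.succ 0))) = Fin.tail (Fin.tail v) := by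
            ext j
            simp only [Fin.tail, Function.comp_apply]
            rw [Equiv.swap_apply_of_ne_of_ne]
            · simp [Fin.ext_iff]
            · simp [Fin.ext_iff]
          have h0 : (v ∘ Equiv.swap (0 : Fin (n + 1)).castSucc (Fin.succ 0)) 0 = v 1 := by
            simp
          have h1 : Fin.tail (v ∘ Equiv.swap (0 : Fin (n + 1)).castSucc (Fin.succ 0)) 0 = v 0 := by
            simp [Fin.tail]
          rw [htail, h0, h1, hsymm.eq]
          rfl
        | succ j =>
          have h0 : (v ∘ Equiv.swap j.succ.castSucc j.succ.succ) 0 = v 0 := by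
            simp only [Function.comp_apply]
            rw [Equiv.swap_apply_of_ne_of_ne]
            · simp [Fin.ext_iff]
            · simp [Fin.ext_iff]
          have htail : Fin.tail (v ∘ Equiv.swap j.succ.castSucc j.succ.succ)
              = Fin.tail v ∘ Equiv.swap j.castSucc j.succ := by
            ext k
            simp only [Fin.tail, Function.comp_apply]
            congr 1
            rw [← Fin.succ_castSucc]
            exact (Fin.succ_injective _).swap_apply j.castSucc j.succ k
          rw [h0, htail]
          have hd : DifferentiableAt ℝ (iteratedFDeriv ℝ (n + 1) f) x :=
            (hdiff (n + 1)).differentiable (by simp) x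
          rw [← fderiv_continuousMultilinear_apply_const_apply hd,
            ← fderiv_continuousMultilinear_apply_const_apply hd]
          congr 2
          ext y
          exact ih y _ _

/-- Polarization: a nonzero iterated derivative of a smooth map is nonzero on some diagonal
vector `(v, …, v)`. -/
theorem ContDiff.exists_iteratedFDeriv_diagonal_ne_zero {f : E → F} (hf : ContDiff ℝ ∞ f) {n : ℕ}
    {x : E} (h : iteratedFDeriv ℝ n f x ≠ 0) :
    ∃ v : E, iteratedFDeriv ℝ n f x (fun _ => v) ≠ 0 := by
  by_contra! hz
  refine h (ContinuousMultilinearMap.ext fun v => ?_)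
  have h₁ := (iteratedFDeriv ℝ n f x).iteratedFDeriv_comp_diagonal 0 v
  have h₂ : (fun y => iteratedFDeriv ℝ n f x (fun _ => y)) = fun _ : E => (0 : F) := funext hz
  rw [h₂] at h₁
  have h₃ : ∀ σ : Equiv.Perm (Fin n), iteratedFDeriv ℝ n f x (fun i => v (σ i))
      = iteratedFDeriv ℝ n f x v := fun σ => hf.iteratedFDeriv_comp_perm_of_smooth n x v σ
  simp only [h₃, Finset.sum_const, Finset.card_univ, Fintype.card_perm] at h₁
  have h₄ : iteratedFDeriv ℝ n (fun _ : E => (0 : F)) 0 v = 0 := by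
    have := iteratedFDeriv_fun_zero (𝕜 := ℝ) (E := E) (F := F) (n := n)
    exact congrArg (fun g => g 0 v) this
  rw [h₄] at h₁
  rw [Fintype.card_fin, ← Nat.cast_smul_eq_nsmul ℝ] at h₁
  exact (smul_eq_zero.1 h₁.symm).resolve_left (by exact_mod_cast n.factorial_ne_zero)

/-- A smooth map whose derivatives of order less than `m` vanish at `0` is `O(‖x‖ ^ m)`. -/
theorem ContDiff.isBigO_norm_pow_of_iteratedFDeriv_eq_zero {f : E → F} (hf : ContDiff ℝ ∞ f)
    {m : ℕ} (h : ∀ k < m, iteratedFDeriv ℝ k f 0 = 0) :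
    f =O[𝓝 0] fun x => ‖x‖ ^ m := by
  induction m generalizing F with
  | zero => simpa using hf.continuous.continuousAt.isBigO_one ℝ
  | succ m ih =>
    have hf' : ContDiff ℝ ∞ (fderiv ℝ f) := hf.fderiv_right (by norm_cast)
    have hD : fderiv ℝ f =O[𝓝 0] fun x => ‖x‖ ^ m := by
      refine ih hf' fun k hk => ?_
      rw [← norm_eq_zero, norm_iteratedFDeriv_fderiv, h (k + 1) (by omega), norm_zero]
    have h0 : f 0 = 0 := by
      have := h 0 (by omega)
      rw [← norm_eq_zero, norm_iteratedFDeriv_zero, norm_eq_zero] at this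
      exact this
    obtain ⟨C, hC0, hC⟩ := hD.exists_nonneg
    obtain ⟨r, hr, hball⟩ := Metric.eventually_nhds_iff_ball.1 hC.bound
    refine Asymptotics.IsBigO.of_bound C ?_
    filter_upwards [Metric.ball_mem_nhds (0 : E) hr] with x hx
    have hseg : segment ℝ 0 x ⊆ Metric.closedBall 0 ‖x‖ :=
      (convex_closedBall (0 : E) ‖x‖).segment_subset (by simp) (by simp)
    have hmv := (convex_segment (0 : E) x).norm_image_sub_le_of_norm_fderiv_le (𝕜 := ℝ) (f := f)
      (C := C * ‖x‖ ^ m) (fun y _ => hf.differentiable (by simp) y) (fun y hy => ?_)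
      (left_mem_segment ℝ 0 x) (right_mem_segment ℝ 0 x)
    · simpa [h0, pow_succ, mul_assoc] using hmv
    · have hy' : ‖y‖ ≤ ‖x‖ := by simpa using hseg hy
      have hx' : ‖x‖ < r := by simpa using hx
      have hb := hball y (by simpa using hy'.trans_lt hx')
      rw [norm_pow, norm_norm] at hb
      exact hb.trans (by gcongr)

end IteratedDerivatives

/-- Taylor expansion to the first nonvanishing order along a line through `0`. -/
theorem ContDiff.isLittleO_sub_iteratedFDeriv_line {E : Type*} [NormedAddCommGroup E]
    [NormedSpace ℝ E] {f : E → ℝ} (hf : ContDiff ℝ ∞ f) {m : ℕ}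
    (h : ∀ k < m, iteratedFDeriv ℝ k f 0 = 0) (v : E) :
    (fun t : ℝ => f (t • v) - t ^ m * ((m.factorial : ℝ)⁻¹ * iteratedFDeriv ℝ m f 0 fun _ => v))
      =o[𝓝 0] fun t : ℝ => t ^ m := by
  set L : ℝ →L[ℝ] E := (ContinuousLinearMap.id ℝ ℝ).smulRight v with hL
  have hk : ContDiff ℝ ∞ (f ∘ L) := hf.comp L.contDiff
  have hder : ∀ k, iteratedDeriv k (f ∘ L) 0 = iteratedFDeriv ℝ k f 0 fun _ => v := by
    intro k
    rw [iteratedDeriv_eq_iteratedFDeriv, L.iteratedFDeriv_comp_right hf 0 (by exact_mod_cast le_top)]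
    simp [hL]
  have ht := taylor_isLittleO_univ (x₀ := 0) (n := m) (hk.of_le (by exact_mod_cast le_top))
  refine (ht.congr_left fun t => ?_).congr_right fun t => by rw [sub_zero]
  rw [taylor_within_apply, Finset.sum_range_succ, Finset.sum_eq_zero]
  · simp only [iteratedDerivWithin_univ, hder]
    simp [hL]
    ring
  · intro k hk
    rw [iteratedDerivWithin_univ, hder, h k (Finset.mem_range.1 hk)]
    simp

namespace InvMetric

/-! ### Vanishing orders -/

theorem vanishingOrder_eq_coe {V : Type*} [NormedAddCommGroup V] [NormedSpace ℝ V] {f : ℂ → V}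
    {m : ℕ} (h : vanishingOrder f = m) :
    iteratedFDeriv ℝ m f 0 ≠ 0 ∧ ∀ k < m, iteratedFDeriv ℝ k f 0 = 0 := by
  have hlow : ∀ k < m, iteratedFDeriv ℝ k f 0 = 0 := by
    intro k hk
    by_contra hne
    have : vanishingOrder f ≤ k := iInf₂_le k hne
    rw [h] at this
    exact absurd (by exact_mod_cast this) (not_le.2 hk)
  refine ⟨fun h0 => ?_, hlow⟩
  have : ((m + 1 : ℕ) : ℕ∞) ≤ vanishingOrder f := by
    refine le_iInf₂ fun k hk => ?_
    by_contra! hlt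
    have hkm : k ≤ m := by
      have : k < m + 1 := by exact_mod_cast hlt
      omega
    rcases hkm.lt_or_eq with hlt' | rfl
    · exact hk (hlow k hlt')
    · exact hk h0
  rw [h] at this
  have : m + 1 ≤ m := by exact_mod_cast this
  omega

theorem vanishingOrder_smul_const {n : ℕ} {ξ : Cn n} (hξ : ξ ≠ 0) :
    vanishingOrder (fun z : ℂ => z • ξ) ≤ 1 := by
  refine iInf₂_le_of_le 1 (fun h => hξ ?_) le_rfl
  have h₁ := norm_iteratedFDeriv_one (𝕜 := ℝ) (fun z : ℂ => z • ξ) (x := 0)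
  rw [h, norm_zero, eq_comm, norm_eq_zero] at h₁
  have h₂ : HasFDerivAt (fun z : ℂ => z • ξ)
      (((ContinuousLinearMap.id ℝ ℂ).smulRight ξ : ℂ →L[ℝ] Cn n)) 0 :=
    ((ContinuousLinearMap.id ℝ ℂ).smulRight ξ : ℂ →L[ℝ] Cn n).hasFDerivAt
  rw [h₂.fderiv] at h₁
  simpa using congrArg (fun g : ℂ →L[ℝ] Cn n => g 1) h₁

variable {n : ℕ} {Ω : Set (Cn n)} {ρ : Cn n → ℝ} {P ξ : Cn n}

/-- Finite type bounds the order of tangency of the complex line in direction `ξ`. -/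
theorem IsFiniteTypeAt.tangencyOrder_ne_top (h : IsFiniteTypeAt ρ P) (hξ : ξ ≠ 0) :
    tangencyOrder ρ P ξ ≠ ⊤ := by
  obtain ⟨C, hC⟩ := h
  have hv : vanishingOrder (fun z : ℂ => P + z • ξ - P) ≤ 1 := by
    simpa using vanishingOrder_smul_const hξ
  have := hC (fun z => P + z • ξ) (by fun_prop) (by simp)
    (ne_top_of_le_ne_top (by simp) hv)
  refine ne_top_of_le_ne_top ?_ (this.trans (mul_le_mul_right hv _))
  simp

/-! ### The boundary near a point -/

namespace IsSmoothlyBounded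

theorem isOpen (h : IsSmoothlyBounded Ω ρ) : IsOpen Ω := by
  rw [h.eq_sublevel]
  exact isOpen_lt h.smooth.continuous continuous_const

theorem mem_iff (h : IsSmoothlyBounded Ω ρ) {z : Cn n} : z ∈ Ω ↔ ρ z < 0 := by
  rw [h.eq_sublevel]; rfl

theorem eq_zero_of_mem_frontier (h : IsSmoothlyBounded Ω ρ) (hP : P ∈ frontier Ω) : ρ P = 0 := by
  rw [h.eq_sublevel] at hP
  exact frontier_lt_subset_eq h.smooth.continuous continuous_const hP

theorem contDiff_line (h : IsSmoothlyBounded Ω ρ) (P ξ : Cn n) :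
    ContDiff ℝ ∞ fun z : ℂ => ρ (P + z • ξ) :=
  h.smooth.comp (contDiff_const.add (contDiff_id.smul contDiff_const))

theorem fderiv_gradient (h : IsSmoothlyBounded Ω ρ) (P : Cn n) :
    fderiv ℝ ρ P (gradient ρ P) = ‖gradient ρ P‖ ^ 2 := by
  have hd : DifferentiableAt ℝ ρ P := h.smooth.differentiable (by simp) P
  have := hd.hasGradientAt.hasFDerivAt.fderiv
  rw [this, InnerProductSpace.toDual_apply_apply, real_inner_self_eq_norm_sq]

theorem fderiv_unitNormal_pos (h : IsSmoothlyBounded Ω ρ) (hP : P ∈ frontier Ω) :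
    0 < fderiv ℝ ρ P (unitNormal ρ P) := by
  have hg : 0 < ‖gradient ρ P‖ := norm_pos_iff.2 (h.gradient_ne_zero P hP)
  rw [unitNormal, map_smul, h.fderiv_gradient, smul_eq_mul]
  positivity

/-- Near the boundary point `P`, the inward displacement by `δ ν` lowers `ρ` by an amount
comparable with `δ`. -/
theorem exists_normal_displacement (h : IsSmoothlyBounded Ω ρ) (hP : P ∈ frontier Ω) :
    ∃ g > 0, ∃ r > 0, ∀ x ∈ Metric.ball P r, ∀ δ, 0 ≤ δ → δ < r →
      ρ (x - δ • unitNormal ρ P) ≤ ρ x - g * δ ∧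
      ρ x - 3 * g * δ ≤ ρ (x - δ • unitNormal ρ P) := by
  set ν := unitNormal ρ P
  set G := fderiv ℝ ρ P ν with hG
  have hG0 : 0 < G := h.fderiv_unitNormal_pos hP
  have hs : HasStrictFDerivAt ρ (fderiv ℝ ρ P) P :=
    (h.smooth.contDiffAt).hasStrictFDerivAt (by simp)
  have hε : 0 < G / (2 * (‖ν‖ + 1)) := by positivity
  have hev := hs.isLittleO.def hε
  obtain ⟨r, hr, hball⟩ := Metric.eventually_nhds_iff_ball.1 hev
  refine ⟨G / 2, by positivity, r / (2 * (‖ν‖ + 1)), by positivity, fun x hx δ hδ hδr => ?_⟩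
  have hrr : r / (2 * (‖ν‖ + 1)) * (‖ν‖ + 1) = r / 2 := by field_simp
  have hr2 : r / (2 * (‖ν‖ + 1)) ≤ r / 2 := by
    nlinarith [norm_nonneg ν, show 0 < r / (2 * (‖ν‖ + 1)) by positivity]
  have hδν : ‖δ • ν‖ < r / 2 := by
    rw [norm_smul, Real.norm_of_nonneg hδ]
    nlinarith [norm_nonneg ν]
  have hx' : dist x P < r / 2 := lt_of_lt_of_le hx hr2
  have hx'' : dist (x - δ • ν) P < r := by
    calc dist (x - δ • ν) P ≤ dist (x - δ • ν) x + dist x P := dist_triangle _ _ _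
      _ < r := by rw [dist_eq_norm, sub_sub_cancel_left, norm_neg]; linarith
  have key := hball (x - δ • ν, x) (by
    rw [Metric.mem_ball, Prod.dist_eq]
    exact max_lt hx'' (by dsimp only; linarith))
  simp only [sub_sub_cancel_left, map_neg, map_smul, smul_eq_mul, norm_neg, norm_smul,
    Real.norm_of_nonneg hδ, Real.norm_eq_abs, ← hG] at key
  have hb : G / (2 * (‖ν‖ + 1)) * (δ * ‖ν‖) ≤ G / 2 * δ := by
    rw [div_mul_eq_mul_div, div_le_iff₀ (by positivity)]
    nlinarith [mul_nonneg hG0.le hδ]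
  have := abs_le.1 (key.trans hb)
  constructor <;> linarith [this.1, this.2]

/-- If `ρ` vanishes to order `m` along the complex line `P + ℂ ξ`, then `Ω` contains a disc of
radius comparable with `δ ^ (1 / m)` about `P - δ ν` in direction `ξ`. -/
theorem exists_disc_subset (h : IsSmoothlyBounded Ω ρ) (hP : P ∈ frontier Ω) {m : ℕ} (hm : m ≠ 0)
    (hO : (fun z : ℂ => ρ (P + z • ξ)) =O[𝓝 0] fun z => ‖z‖ ^ m) :
    ∃ c > (0 : ℝ), ∀ᶠ δ : ℝ in 𝓝[>] 0, ∀ z : ℂ, ‖z‖ ≤ c * δ ^ (1 / (m : ℝ)) →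
      P - δ • unitNormal ρ P + z • ξ ∈ Ω := by
  obtain ⟨g, hg, r, hr, hdisp⟩ := h.exists_normal_displacement hP
  obtain ⟨C, hC, hOC⟩ := hO.exists_pos
  obtain ⟨s, hs, hball⟩ := Metric.eventually_nhds_iff_ball.1 hOC.bound
  set c := min 1 (g / (2 * C)) with hc
  have hc0 : 0 < c := by positivity
  have hcm : C * c ^ m ≤ g / 2 := by
    have h₁ : c ^ m ≤ c := pow_le_of_le_one hc0.le (min_le_left _ _) hm
    have h₂ : c ≤ g / (2 * C) := min_le_right _ _
    calc C * c ^ m ≤ C * (g / (2 * C)) := by gcongr; exact h₁.trans h₂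
      _ = g / 2 := by field_simp
  have hlim : Tendsto (fun δ : ℝ => c * δ ^ (1 / (m : ℝ))) (𝓝[>] 0) (𝓝 0) := by
    have : ContinuousAt (fun δ : ℝ => c * δ ^ (1 / (m : ℝ))) 0 :=
      continuousAt_const.mul (Real.continuousAt_rpow_const _ _ (Or.inr (by positivity)))
    have h0 : c * (0 : ℝ) ^ (1 / (m : ℝ)) = 0 := by
      rw [Real.zero_rpow (by positivity), mul_zero]
    simpa only [h0] using this.tendsto.mono_left (nhdsWithin_le_nhds (s := Ioi 0))
  refine ⟨c, hc0, ?_⟩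
  filter_upwards [self_mem_nhdsWithin, nhdsWithin_le_nhds (Iio_mem_nhds hr),
    hlim.eventually (Iio_mem_nhds hs),
    hlim.eventually (Iio_mem_nhds (show 0 < r / (‖ξ‖ + 1) by positivity))] with δ hδ hδr hδs hδξ z hz
  simp only [mem_Iio, mem_Ioi] at hδ hδr hδs hδξ
  have hzξ : ‖z • ξ‖ < r := by
    rw [norm_smul]
    rw [lt_div_iff₀ (by positivity)] at hδξ
    nlinarith [norm_nonneg ξ, norm_nonneg z]
  have h₁ := (hdisp (P + z • ξ) (by simpa using hzξ) δ hδ.le hδr).1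
  have h₂ := hball z (by simpa using hz.trans_lt hδs)
  have h₃ : ‖z‖ ^ m ≤ c ^ m * δ := by
    calc ‖z‖ ^ m ≤ (c * δ ^ (1 / (m : ℝ))) ^ m := by gcongr
      _ = c ^ m * δ := by
        rw [mul_pow, one_div, Real.rpow_inv_natCast_pow hδ.le hm]
  rw [norm_pow, norm_norm, Real.norm_eq_abs] at h₂
  have h₄ : C * ‖z‖ ^ m ≤ g / 2 * δ := by
    calc C * ‖z‖ ^ m ≤ C * (c ^ m * δ) := by gcongr
      _ = (C * c ^ m) * δ := by ring
      _ ≤ g / 2 * δ := by gcongr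
  rw [h.mem_iff, show P - δ • unitNormal ρ P + z • ξ = P + z • ξ - δ • unitNormal ρ P by abel]
  nlinarith [le_abs_self (ρ (P + z • ξ)), mul_pos hg hδ]

/-- If `ρ` grows at least like `a t ^ m` along a ray in the complex line `P + ℂ ξ`, then that line,
shifted to `P - δ ν`, leaves `Ω` within a distance comparable with `δ ^ (1 / m)`. -/
theorem exists_notMem (h : IsSmoothlyBounded Ω ρ) (hP : P ∈ frontier Ω) {m : ℕ} (hm : m ≠ 0)
    {a : ℝ} (ha : 0 < a) {v : ℂ} (hv : ∀ᶠ t : ℝ in 𝓝[>] 0, a * t ^ m ≤ ρ (P + (t • v) • ξ)) :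
    ∃ K > (0 : ℝ), ∀ᶠ δ : ℝ in 𝓝[>] 0, ∃ z : ℂ, ‖z‖ ≤ K * δ ^ (1 / (m : ℝ)) ∧
      P - δ • unitNormal ρ P + z • ξ ∉ Ω := by
  obtain ⟨g, hg, r, hr, hdisp⟩ := h.exists_normal_displacement hP
  set K := max 1 (3 * g / a) with hK
  have hK0 : 0 < K := lt_max_of_lt_left one_pos
  have hKm : 3 * g ≤ a * K ^ m := by
    have h₁ : K ≤ K ^ m := le_self_pow₀ (le_max_left _ _) hm
    have h₂ : 3 * g / a ≤ K := le_max_right _ _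
    rw [div_le_iff₀ ha] at h₂
    nlinarith
  have hlim : Tendsto (fun δ : ℝ => K * δ ^ (1 / (m : ℝ))) (𝓝[>] 0) (𝓝[>] 0) := by
    have : ContinuousAt (fun δ : ℝ => K * δ ^ (1 / (m : ℝ))) 0 :=
      continuousAt_const.mul (Real.continuousAt_rpow_const _ _ (Or.inr (by positivity)))
    have h0 : K * (0 : ℝ) ^ (1 / (m : ℝ)) = 0 := by
      rw [Real.zero_rpow (by positivity), mul_zero]
    refine tendsto_nhdsWithin_iff.2
      ⟨by simpa only [h0] using this.tendsto.mono_left (nhdsWithin_le_nhds (s := Ioi 0)), ?_⟩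
    filter_upwards [self_mem_nhdsWithin] with δ hδ
    exact mul_pos hK0 (Real.rpow_pos_of_pos hδ _)
  refine ⟨K * (‖v‖ + 1), by positivity, ?_⟩
  filter_upwards [self_mem_nhdsWithin, nhdsWithin_le_nhds (Iio_mem_nhds hr), hlim.eventually hv,
    (tendsto_nhdsWithin_iff.1 hlim).1.eventually
      (Iio_mem_nhds (show 0 < r / (‖v‖ * ‖ξ‖ + 1) by positivity))] with δ hδ hδr hδv hδξ
  simp only [mem_Iio, mem_Ioi] at hδ hδr hδξ
  set t := K * δ ^ (1 / (m : ℝ)) with ht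
  have ht0 : 0 < t := mul_pos hK0 (Real.rpow_pos_of_pos hδ _)
  refine ⟨t • v, ?_, ?_⟩
  · rw [norm_smul, Real.norm_of_nonneg ht0.le]
    calc t * ‖v‖ ≤ t * (‖v‖ + 1) := by gcongr; linarith
      _ = _ := by rw [ht]; ring
  · have hzξ : ‖(t • v) • ξ‖ < r := by
      rw [norm_smul, norm_smul, Real.norm_of_nonneg ht0.le]
      rw [lt_div_iff₀ (by positivity)] at hδξ
      nlinarith
    have h₁ := (hdisp (P + (t • v) • ξ) (by simpa using hzξ) δ hδ.le hδr).2
    have htm : t ^ m = K ^ m * δ := by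
      rw [ht, mul_pow, one_div, Real.rpow_inv_natCast_pow hδ.le hm]
    rw [htm] at hδv
    rw [h.mem_iff, not_lt, show P - δ • unitNormal ρ P + (t • v) • ξ
      = P + (t • v) • ξ - δ • unitNormal ρ P by abel]
    nlinarith

/-- The real tangent hyperplane of a convex domain does not meet the domain. -/
theorem notMem_of_fderiv_eq_zero (h : IsSmoothlyBounded Ω ρ) (hconv : Convex ℝ Ω)
    (hP : P ∈ frontier Ω) {w : Cn n} (hw : fderiv ℝ ρ P w = 0) : P + w ∉ Ω := by
  intro hmem
  -- Push the point of `Ω` outwards a little, so that `ρ` increases from `P` towards it.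
  have hcont : Tendsto (fun η : ℝ => P + w + η • gradient ρ P) (𝓝[>] 0) (𝓝 (P + w)) := by
    have : Continuous fun η : ℝ => P + w + η • gradient ρ P := by fun_prop
    simpa using (this.tendsto 0).mono_left (nhdsWithin_le_nhds (s := Ioi 0))
  obtain ⟨η, hη, hη0⟩ := ((hcont.eventually (h.isOpen.mem_nhds hmem)).and
    self_mem_nhdsWithin).exists
  have hη0 : 0 < η := hη0
  have hg : 0 < ‖gradient ρ P‖ := norm_pos_iff.2 (h.gradient_ne_zero P hP)
  set d := w + η • gradient ρ P with hd
  have hdpos : 0 < fderiv ℝ ρ P d := by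
    rw [hd, map_add, hw, map_smul, h.fderiv_gradient, smul_eq_mul]
    positivity
  have hρ0 := h.eq_zero_of_mem_frontier hP
  have hder : HasDerivAt (fun t : ℝ => ρ (P + t • d)) (fderiv ℝ ρ P d) 0 := by
    have h₁ : HasDerivAt (fun t : ℝ => P + t • d) d 0 := by
      simpa using ((hasDerivAt_id (0 : ℝ)).smul_const d).const_add P
    have h₂ : HasFDerivAt ρ (fderiv ℝ ρ P) (P + (0 : ℝ) • d) := by
      simpa using (h.smooth.differentiable (by simp) P).hasFDerivAt
    exact h₂.comp_hasDerivAt 0 h₁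
  have hev : ∀ᶠ t : ℝ in 𝓝[>] 0, 0 < ρ (P + t • d) := by
    have := hder.tendsto_slope.eventually (Ioi_mem_nhds hdpos)
    filter_upwards [this.filter_mono (nhdsWithin_mono _ (fun x hx => ne_of_gt hx)),
      self_mem_nhdsWithin] with t ht ht0
    have ht0 : 0 < t := ht0
    simp only [slope, sub_zero, zero_smul, add_zero, hρ0, vsub_eq_sub, smul_eq_mul] at ht
    exact (pos_iff_pos_of_mul_pos ht).1 (by positivity)
  obtain ⟨t, ht, ht01⟩ := (hev.and (Ioo_mem_nhdsGT (zero_lt_one (α := ℝ)))).exists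
  have hmem' : P + t • d ∈ Ω := by
    have hsub := hconv.openSegment_interior_closure_subset_interior
      (x := P + w + η • gradient ρ P) (y := P) (by rwa [h.isOpen.interior_eq])
      (frontier_subset_closure hP)
    rw [h.isOpen.interior_eq] at hsub
    refine hsub ⟨t, 1 - t, ht01.1, by linarith [ht01.2], by ring, ?_⟩
    rw [hd]; module
  exact absurd (h.mem_iff.1 hmem') (not_lt.2 ht.le)

end IsSmoothlyBounded

theorem fderiv_smul_eq_zero_of_mem_complexTangentSpace (hξ : ξ ∈ complexTangentSpace ρ P) (z : ℂ) :
    fderiv ℝ ρ P (z • ξ) = 0 := by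
  have : z • ξ = z.re • ξ + z.im • (Complex.I • ξ) := by
    conv_lhs => rw [← Complex.re_add_im z]
    rw [add_smul, mul_smul]
    rfl
  rw [this, map_add, map_smul, map_smul, hξ.1, hξ.2]
  simp

/-- On a convex domain `ρ` is nonnegative on the complex line `P + ℂ ξ` in the tangent hyperplane,
so its leading term there is nonnegative, and being nonzero it is positive in some direction. -/
theorem IsSmoothlyBounded.exists_growth (h : IsSmoothlyBounded Ω ρ) (hconv : Convex ℝ Ω)
    (hP : P ∈ frontier Ω) (hξ : ξ ∈ complexTangentSpace ρ P) {m : ℕ}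
    (hm : tangencyOrder ρ P ξ = m) :
    ∃ a > 0, ∃ v : ℂ, ∀ᶠ t : ℝ in 𝓝[>] 0, a * t ^ m ≤ ρ (P + (t • v) • ξ) := by
  obtain ⟨hne, hlow⟩ := vanishingOrder_eq_coe hm
  have hsm := h.contDiff_line P ξ
  obtain ⟨v, hv⟩ := hsm.exists_iteratedFDeriv_diagonal_ne_zero hne
  set A := (m.factorial : ℝ)⁻¹ * iteratedFDeriv ℝ m (fun z : ℂ => ρ (P + z • ξ)) 0 fun _ => v
    with hA
  have hA0 : A ≠ 0 := mul_ne_zero (by positivity) hv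
  have hlo := (hsm.isLittleO_sub_iteratedFDeriv_line hlow v).def
    (show 0 < |A| / 2 by positivity)
  have hev : ∀ᶠ t : ℝ in 𝓝[>] 0, 0 < t ∧
      |ρ (P + (t • v) • ξ) - t ^ m * A| ≤ |A| / 2 * t ^ m := by
    filter_upwards [nhdsWithin_le_nhds hlo, self_mem_nhdsWithin] with t ht ht0
    have ht0 : 0 < t := ht0
    refine ⟨ht0, ?_⟩
    simpa only [Real.norm_eq_abs, abs_of_pos (pow_pos ht0 m)] using ht
  have hApos : 0 < A := by
    by_contra! hle
    obtain ⟨t, ht0, ht⟩ := hev.exists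
    have hneg : A < 0 := lt_of_le_of_ne hle hA0
    have hnn : 0 ≤ ρ (P + (t • v) • ξ) := by
      by_contra! hlt
      exact h.notMem_of_fderiv_eq_zero hconv hP
        (fderiv_smul_eq_zero_of_mem_complexTangentSpace hξ (t • v)) (h.mem_iff.2 hlt)
    rw [abs_of_neg hneg] at ht
    nlinarith [(abs_le.1 ht).2, mul_pos (neg_pos.2 hneg) (pow_pos ht0 m)]
  refine ⟨A / 2, by positivity, v, ?_⟩
  filter_upwards [hev] with t ht
  rw [abs_of_pos hApos] at ht
  nlinarith [(abs_le.1 ht.2).1]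

end InvMetric

namespace InvMetric

/-! ### Circle means and subharmonic functions of one variable -/

theorem circleMean_mono {g h : ℂ → EReal} (hgh : ∀ z ∈ Metric.sphere (0 : ℂ) 1, g z ≤ h z) :
    circleMean g ≤ circleMean h := by
  have hθ : ∀ θ : ℝ, g (Complex.exp (θ * Complex.I)) ≤ h (Complex.exp (θ * Complex.I)) :=
    fun θ => hgh _ (by simp [Complex.norm_exp_ofReal_mul_I])
  refine EReal.sub_le_sub ?_ ?_
  · rw [EReal.coe_ennreal_le_coe_ennreal_iff]
    gcongr with θ
    exact EReal.toENNReal_le_toENNReal (hθ θ)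
  · rw [EReal.coe_ennreal_le_coe_ennreal_iff]
    gcongr with θ
    exact EReal.toENNReal_le_toENNReal (EReal.neg_le_neg_iff.2 (hθ θ))

/-- The circle mean of an extended real valued function that is almost everywhere equal to an
integrable real function is the Bochner average of the latter. -/
theorem circleMean_eq_circleAverage {g : ℂ → EReal} {h : ℂ → ℝ} (hint : CircleIntegrable h 0 1)
    (hgh : ∀ᵐ θ : ℝ ∂volume.restrict (Ioc 0 (2 * Real.pi)),
      g (Complex.exp (θ * Complex.I)) = h (Complex.exp (θ * Complex.I))) :
    circleMean g = Real.circleAverage h 0 1 := by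
  have hcm : ∀ θ : ℝ, circleMap 0 1 θ = Complex.exp (θ * Complex.I) := by simp [circleMap]
  have hπ : 0 < 2 * Real.pi := Real.two_pi_pos
  have hI : IntegrableOn (fun θ : ℝ => h (Complex.exp (θ * Complex.I))) (Ioc 0 (2 * Real.pi)) := by
    have := (intervalIntegrable_iff_integrableOn_Ioc_of_le hπ.le).1 hint
    simpa only [hcm] using this
  have hpos : ∫⁻ θ in Ioc (0 : ℝ) (2 * Real.pi), (g (Complex.exp (θ * Complex.I))).toENNReal
      = ∫⁻ θ in Ioc (0 : ℝ) (2 * Real.pi), ENNReal.ofReal (h (Complex.exp (θ * Complex.I))) :=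
    lintegral_congr_ae (hgh.mono fun θ hθ => by
      simp only [hθ, EReal.real_coe_toENNReal])
  have hneg : ∫⁻ θ in Ioc (0 : ℝ) (2 * Real.pi), (-g (Complex.exp (θ * Complex.I))).toENNReal
      = ∫⁻ θ in Ioc (0 : ℝ) (2 * Real.pi), ENNReal.ofReal (-h (Complex.exp (θ * Complex.I))) :=
    lintegral_congr_ae (hgh.mono fun θ hθ => by
      simp only [hθ, ← EReal.coe_neg, EReal.real_coe_toENNReal])
  have hfin : ∀ k : ℝ → ℝ, IntegrableOn k (Ioc 0 (2 * Real.pi)) →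
      ∫⁻ θ in Ioc (0 : ℝ) (2 * Real.pi), ENNReal.ofReal (k θ) ≠ ⊤ := fun k hk =>
    ((lintegral_mono fun θ => ENNReal.ofReal_le_ofReal (le_abs_self (k θ))).trans_lt (by
      have := hk.2
      simpa only [HasFiniteIntegral, ← Real.enorm_eq_ofReal_abs] using this)).ne
  have hdiv : ∀ A : ℝ≥0∞, A ≠ ⊤ → ((A / ENNReal.ofReal (2 * Real.pi) : ℝ≥0∞) : EReal)
      = ((A.toReal / (2 * Real.pi) : ℝ) : EReal) := by
    intro A hA
    rw [← EReal.coe_ennreal_toReal (ENNReal.div_ne_top hA (by simpa using Real.pi_pos)),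
      ENNReal.toReal_div, ENNReal.toReal_ofReal hπ.le]
  rw [circleMean, hpos, hneg, hdiv _ (hfin _ hI), hdiv _ (hfin (fun θ => -h (Complex.exp (θ * Complex.I))) hI.neg), ← EReal.coe_sub,
    Real.circleAverage_def, intervalIntegral.integral_of_le hπ.le]
  simp only [hcm]
  rw [integral_eq_lintegral_pos_part_sub_lintegral_neg_part hI, smul_eq_mul]
  congr 1
  ring

/-- Jensen's inequality: `log |f|²` has the sub-mean value property for holomorphic `f`. -/
theorem log_norm_sq_le_circleMean {f : ℂ → ℂ} (hf : AnalyticOnNhd ℂ f (Metric.closedBall 0 1)) :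
    ENNReal.log (ENNReal.ofReal (‖f 0‖ ^ 2))
      ≤ circleMean fun z => ENNReal.log (ENNReal.ofReal (‖f z‖ ^ 2)) := by
  rcases eq_or_ne (f 0) 0 with h0 | h0
  · simp [h0]
  have habs : Metric.closedBall (0 : ℂ) |1| = Metric.closedBall 0 1 := by rw [abs_one]
  have hf' : AnalyticOnNhd ℂ f (Metric.closedBall 0 |1|) := by rwa [habs]
  have hint : CircleIntegrable (fun z => Real.log ‖f z‖) 0 1 :=
    (hf'.mono Metric.sphere_subset_closedBall).meromorphicOn.circleIntegrable_log_norm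
  have hint2 : CircleIntegrable (fun z => 2 * Real.log ‖f z‖) 0 1 := hint.const_mul 2
  -- The zeros of `f` on the circle form a null set.
  have hae : ∀ᵐ θ : ℝ ∂volume.restrict (Ioc 0 (2 * Real.pi)),
      f (Complex.exp (θ * Complex.I)) ≠ 0 := by
    have h₁ : f ⁻¹' {0}ᶜ ∈ codiscreteWithin (Metric.sphere (0 : ℂ) |1|) :=
      codiscreteWithin_mono Metric.sphere_subset_closedBall
        (hf'.preimage_zero_mem_codiscreteWithin h0 (by simp)
          ((convex_closedBall (0 : ℂ) |1|).isConnected (by simp)))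
    have h₂ := ae_restrict_le_codiscreteWithin (μ := volume)
      (measurableSet_Ioc (a := (0 : ℝ)) (b := 2 * Real.pi))
      (codiscreteWithin_mono (subset_univ _) (circleMap_preimage_codiscrete one_ne_zero h₁))
    filter_upwards [h₂] with θ hθ
    simpa [circleMap] using hθ
  rw [circleMean_eq_circleAverage hint2]
  · have hJ := AnalyticOnNhd.circleAverage_log_norm one_ne_zero hf' h0
    have hnn : 0 ≤ ∑ᶠ u, MeromorphicOn.divisor f (Metric.closedBall 0 |1|) u
        * Real.log (1 * ‖(0 : ℂ) - u‖⁻¹) := by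
      refine finsum_nonneg fun u => ?_
      by_cases hu : u ∈ Metric.closedBall (0 : ℂ) |1|
      · refine mul_nonneg (by exact_mod_cast MeromorphicOn.AnalyticOnNhd.divisor_nonneg hf' u) ?_
        have hu1 : ‖u‖ ≤ 1 := by simpa using hu
        rcases eq_or_ne u 0 with rfl | hu0
        · simp
        · refine Real.log_nonneg ?_
          rw [one_mul, zero_sub, norm_neg]
          exact (one_le_inv₀ (norm_pos_iff.2 hu0)).2 hu1
      · rw [Function.locallyFinsuppWithin.apply_eq_zero_of_notMem _ hu]
        simp
    have hmul : Real.circleAverage (fun z => 2 * Real.log ‖f z‖) 0 1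
        = 2 * Real.circleAverage (fun z => Real.log ‖f z‖) 0 1 := by
      simpa using Real.circleAverage_fun_smul (a := (2 : ℝ)) (f := fun z => Real.log ‖f z‖)
        (c := 0) (R := 1)
    have hpos : 0 < ‖f 0‖ := norm_pos_iff.2 h0
    rw [ENNReal.log_ofReal_of_pos (by positivity), EReal.coe_le_coe_iff, hmul, hJ, Real.log_pow]
    push_cast
    linarith
  · filter_upwards [hae] with θ hθ
    have hpos : 0 < ‖f (Complex.exp (θ * Complex.I))‖ := norm_pos_iff.2 hθ
    rw [ENNReal.log_ofReal_of_pos (by positivity), Real.log_pow]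
    norm_cast

/-- The average of `A + B log |z| - ε |z|²` over a circle about `z₀` that does not enclose the
origin. For `ε > 0` it is smaller than the value at `z₀` by `ε s²`. -/
theorem circleAverage_log_sub_norm_sq {z₀ : ℂ} {s : ℝ} (hs : 0 ≤ s) (hsz : s < ‖z₀‖) (A B ε : ℝ) :
    CircleIntegrable (fun w => A + B * Real.log ‖z₀ + s * w‖ - ε * ‖z₀ + s * w‖ ^ 2) 0 1 ∧
    Real.circleAverage (fun w => A + B * Real.log ‖z₀ + s * w‖ - ε * ‖z₀ + s * w‖ ^ 2) 0 1
      = A + B * Real.log ‖z₀‖ - ε * (‖z₀‖ ^ 2 + s ^ 2) := by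
  -- On the circle `|z₀ + s w|²` agrees with a function harmonic in `w`.
  set H : ℂ → ℝ := (B • fun w : ℂ => Real.log ‖z₀ + s * w‖) +
    fun w : ℂ => ((A - ε * (‖z₀‖ ^ 2 + s ^ 2) : ℝ)
      - 2 * ε * s * (starRingEnd ℂ z₀ * w)).re with hH
  have hne : ∀ w ∈ Metric.closedBall (0 : ℂ) |1|, z₀ + s * w ≠ 0 := by
    intro w hw h
    have hw1 : ‖w‖ ≤ 1 := by simpa using hw
    have h₁ : ‖z₀‖ = s * ‖w‖ := by
      rw [eq_neg_of_add_eq_zero_left h, norm_neg, norm_mul, Complex.norm_real,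
        Real.norm_of_nonneg hs]
    nlinarith [norm_nonneg w]
  have hharm : InnerProductSpace.HarmonicOnNhd H (Metric.closedBall 0 |1|) := by
    intro w hw
    refine InnerProductSpace.HarmonicAt.add (InnerProductSpace.HarmonicAt.const_smul ?_) ?_
    · exact AnalyticAt.harmonicAt_log_norm (f := fun w : ℂ => z₀ + s * w) (by fun_prop) (hne w hw)
    · exact AnalyticAt.harmonicAt_re (f := fun w : ℂ => ((A - ε * (‖z₀‖ ^ 2 + s ^ 2) : ℝ) : ℂ)
        - 2 * ε * s * (starRingEnd ℂ z₀ * w)) (by fun_prop)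
  have hEq : EqOn (fun w => A + B * Real.log ‖z₀ + s * w‖ - ε * ‖z₀ + s * w‖ ^ 2) H
      (Metric.sphere 0 |1|) := by
    intro w hw
    have hw1 : ‖w‖ = 1 := by simpa using hw
    have hw2 : w.re * w.re + w.im * w.im = 1 := by
      rw [← Complex.normSq_apply, Complex.normSq_eq_norm_sq, hw1, one_pow]
    have h₁ : ‖z₀ + s * w‖ ^ 2
        = ‖z₀‖ ^ 2 + s ^ 2 + 2 * s * (starRingEnd ℂ z₀ * w).re := by
      rw [← Complex.normSq_eq_norm_sq, ← Complex.normSq_eq_norm_sq, Complex.normSq_apply,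
        Complex.normSq_apply]
      simp
      linear_combination s ^ 2 * hw2
    have h₂ : (2 * (ε : ℂ) * s * (starRingEnd ℂ z₀ * w)).re
        = 2 * ε * s * (starRingEnd ℂ z₀ * w).re := by
      have : (2 * (ε : ℂ) * s) = ((2 * ε * s : ℝ) : ℂ) := by push_cast; ring
      rw [this, Complex.re_ofReal_mul]
    simp only [hH, Pi.add_apply, Pi.smul_apply, smul_eq_mul, Complex.sub_re, Complex.ofReal_re, h₁,
      h₂]
    ring
  refine ⟨?_, ?_⟩
  · refine (ContinuousOn.congr (hharm.continuousOn.mono Metric.sphere_subset_closedBall)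
      hEq).circleIntegrable'
  · rw [Real.circleAverage_congr_sphere hEq, hharm.circleAverage_eq]
    simp only [hH, Pi.add_apply, Pi.smul_apply, smul_eq_mul, mul_zero, add_zero, sub_zero,
      Complex.ofReal_re]
    ring

/-- A Schwarz lemma for logarithmically subharmonic functions: if `U ≤ 1` on the unit disc,
`log U⁺` is subharmonic and `U` vanishes to second order at `0`, then `U ≤ |z|²`. The maximum
principle is applied to `log U - (2 - ε) log |z| + ε |z|²`, which tends to `-∞` at `0` and, being
strictly subharmonic, has no interior maximum. -/
theorem le_norm_sq_of_log_subharmonic {U : ℂ → ℝ}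
    (husc : UpperSemicontinuousOn U (Metric.closedBall 0 1))
    (h1 : ∀ z ∈ Metric.closedBall (0 : ℂ) 1, U z ≤ 1)
    (hO : U =O[𝓝 0] fun z => ‖z‖ ^ 2)
    (hsub : ∀ (z : ℂ) (s : ℝ), 0 < s → Metric.closedBall z s ⊆ Metric.closedBall 0 1 →
      ENNReal.log (ENNReal.ofReal (U z))
        ≤ circleMean fun w => ENNReal.log (ENNReal.ofReal (U (z + s * w)))) :
    ∀ z ∈ Metric.closedBall (0 : ℂ) 1, U z ≤ ‖z‖ ^ 2 := by
  obtain ⟨C, hC, hOC⟩ := hO.exists_pos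
  obtain ⟨r₁, hr₁, hball⟩ := Metric.eventually_nhds_iff_ball.1 hOC.bound
  have hmain : ∀ ε ∈ Ioo (0 : ℝ) 1, ∀ z ∈ Metric.closedBall (0 : ℂ) 1, z ≠ 0 →
      U z ≤ Real.exp (ε + (2 - ε) * Real.log ‖z‖ - ε * ‖z‖ ^ 2) := by
    intro ε hε z₁ hz₁ hz₁0
    by_contra! hlt
    set k : ℂ → ℝ := fun z => Real.exp (-((2 - ε) * Real.log ‖z‖ - ε * ‖z‖ ^ 2)) with hk
    have hkpos : ∀ z, 0 < k z := fun z => Real.exp_pos _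
    have hW₁ : Real.exp ε < U z₁ * k z₁ := by
      have := mul_lt_mul_of_pos_right hlt (hkpos z₁)
      rwa [hk, ← Real.exp_add, show ε + (2 - ε) * Real.log ‖z₁‖ - ε * ‖z₁‖ ^ 2
        + -((2 - ε) * Real.log ‖z₁‖ - ε * ‖z₁‖ ^ 2) = ε by ring] at this
    -- Near the origin the quotient is small.
    obtain ⟨r₂, hr₂, hsmall⟩ : ∃ r > 0, ∀ z : ℂ, z ≠ 0 → ‖z‖ ≤ r → U z * k z ≤ Real.exp ε := by
      have hlim : Tendsto (fun x : ℝ => C * Real.exp (ε * Real.log x + ε)) (𝓝[>] 0) (𝓝 0) := by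
        have h₁ : Tendsto (fun x : ℝ => ε * Real.log x + ε) (𝓝[>] 0) atBot :=
          tendsto_atBot_add_const_right _ _ (Real.tendsto_log_nhdsGT_zero.const_mul_atBot hε.1)
        simpa using (Real.tendsto_exp_atBot.comp h₁).const_mul C
      have hev := (hlim.eventually (Iio_mem_nhds (Real.exp_pos ε))).and
        (inter_mem (Ioo_mem_nhdsGT hr₁) (Ioo_mem_nhdsGT (zero_lt_one (α := ℝ))))
      obtain ⟨r, hr, hrs⟩ := mem_nhdsGT_iff_exists_Ioc_subset.1 hev
      refine ⟨r, hr, fun z hz hzr => ?_⟩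
      have hz0 : 0 < ‖z‖ := norm_pos_iff.2 hz
      obtain ⟨hx₁, hx₂, hx₃⟩ := hrs ⟨hz0, hzr⟩
      have hUz := hball z (by simpa using hx₂.2)
      rw [norm_pow, norm_norm, Real.norm_eq_abs] at hUz
      have hsq : ‖z‖ ^ 2 = Real.exp (2 * Real.log ‖z‖) := by
        rw [← Real.exp_log hz0, ← Real.exp_nat_mul]; simp
      calc U z * k z ≤ C * Real.exp (2 * Real.log ‖z‖) * k z := by
            rw [← hsq]
            exact mul_le_mul_of_nonneg_right ((le_abs_self _).trans hUz) (hkpos z).le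
        _ = C * Real.exp (ε * Real.log ‖z‖ + ε * ‖z‖ ^ 2) := by
            rw [mul_assoc, hk, ← Real.exp_add]; ring_nf
        _ ≤ C * Real.exp (ε * Real.log ‖z‖ + ε) := by
            have hz1 : ‖z‖ ^ 2 ≤ 1 := pow_le_one₀ hz0.le hx₃.2.le
            gcongr
            nlinarith [hε.1]
        _ ≤ Real.exp ε := le_of_lt hx₁
    -- The maximum over the remaining annulus is attained at an interior point `z₀`.
    set K : Set ℂ := Metric.closedBall 0 1 ∩ {z | r₂ ≤ ‖z‖} with hK
    have hKc : IsCompact K :=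
      (isCompact_closedBall 0 1).inter_right (isClosed_le continuous_const continuous_norm)
    have hz₁K : z₁ ∈ K := by
      refine ⟨hz₁, ?_⟩
      by_contra hlt'
      exact absurd (hsmall z₁ hz₁0 (not_le.1 hlt').le) (not_le.2 hW₁)
    have hWusc : UpperSemicontinuousOn (fun z => U z * k z) K := by
      intro z hz c hc
      have hz0 : z ≠ 0 := norm_pos_iff.1 (hr₂.trans_le hz.2)
      have hkc : ContinuousAt k z := by
        have : ‖z‖ ≠ 0 := norm_ne_zero_iff.2 hz0
        fun_prop (disch := assumption)
      obtain ⟨c', hc'1, hc'2⟩ := exists_between ((lt_div_iff₀ (hkpos z)).2 hc)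
      have hev₁ := husc.mono inter_subset_left z hz c' hc'1
      have hev₂ : ∀ᶠ y in 𝓝 z, c' * k y < c :=
        (continuousAt_const.mul hkc).eventually (Iio_mem_nhds ((lt_div_iff₀ (hkpos z)).1 hc'2))
      filter_upwards [hev₁, nhdsWithin_le_nhds hev₂] with y hy₁ hy₂
      exact (mul_lt_mul_of_pos_right hy₁ (hkpos y)).trans hy₂
    obtain ⟨z₀, hz₀K, hmax⟩ := hWusc.exists_isMaxOn ⟨z₁, hz₁K⟩ hKc
    have hmax' : ∀ z ∈ K, U z * k z ≤ U z₀ * k z₀ := fun z hz => hmax hz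
    have hM : Real.exp ε < U z₀ * k z₀ := hW₁.trans_le (hmax' z₁ hz₁K)
    have hz₀pos : 0 < ‖z₀‖ := hr₂.trans_le hz₀K.2
    have hz₀r : r₂ < ‖z₀‖ := by
      by_contra! hle
      exact absurd (hsmall z₀ (norm_pos_iff.1 hz₀pos) hle) (not_le.2 hM)
    have hz₀1 : ‖z₀‖ < 1 := by
      refine lt_of_le_of_ne (by simpa using hz₀K.1) fun heq => ?_
      have hkε : k z₀ = Real.exp ε := by simp [hk, heq]
      rw [hkε] at hM
      nlinarith [h1 z₀ hz₀K.1, Real.exp_pos ε]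
    have hU₀ : 0 < U z₀ := by
      by_contra! hle
      nlinarith [hkpos z₀, Real.exp_pos ε]
    obtain ⟨s, hs0, hs1⟩ := exists_between (show 0 < min (1 - ‖z₀‖) (‖z₀‖ - r₂) by
      simp only [lt_min_iff]; constructor <;> linarith)
    have hs2 : s < 1 - ‖z₀‖ := hs1.trans_le (min_le_left _ _)
    have hs3 : s < ‖z₀‖ - r₂ := hs1.trans_le (min_le_right _ _)
    have hsubK : Metric.closedBall z₀ s ⊆ K := by
      intro z hz
      have hzd : ‖z - z₀‖ ≤ s := by simpa [dist_eq_norm] using hz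
      have ha := norm_le_norm_add_norm_sub' z z₀
      have hb := norm_le_norm_add_norm_sub' z₀ z
      rw [norm_sub_rev] at hb
      exact ⟨by simp only [Metric.mem_closedBall, dist_zero_right]; linarith,
        show r₂ ≤ ‖z‖ by linarith⟩
    -- Sub-mean value property at `z₀` against the strictly superharmonic majorant.
    set A := Real.log (U z₀ * k z₀) with hA
    have hv := hsub z₀ s hs0 (hsubK.trans inter_subset_left)
    obtain ⟨hint, havg⟩ := circleAverage_log_sub_norm_sq hs0.le (show s < ‖z₀‖ by linarith) A
      (2 - ε) ε
    have hle : circleMean (fun w => ENNReal.log (ENNReal.ofReal (U (z₀ + s * w))))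
        ≤ circleMean fun w => ((A + (2 - ε) * Real.log ‖z₀ + s * w‖
          - ε * ‖z₀ + s * w‖ ^ 2 : ℝ) : EReal) := by
      refine circleMean_mono fun w hw => ?_
      have hw1 : ‖w‖ = 1 := by simpa using hw
      have hwK : z₀ + s * w ∈ K := hsubK (by
        simp [hw1, abs_of_pos hs0])
      have hWw := hmax' _ hwK
      rw [ENNReal.log_ofReal]
      split_ifs with hUw
      · exact bot_le
      · rw [EReal.coe_le_coe_iff]
        have hUw' := not_le.1 hUw
        have := Real.log_le_log (mul_pos hUw' (hkpos _)) hWw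
        rw [Real.log_mul hUw'.ne' (hkpos _).ne', hk, Real.log_exp] at this
        linarith
    have hfin := (hv.trans hle).trans_eq
      (circleMean_eq_circleAverage hint (Eventually.of_forall fun θ => by rfl))
    rw [havg, ENNReal.log_ofReal_of_pos hU₀, EReal.coe_le_coe_iff, hA,
      Real.log_mul hU₀.ne' (hkpos _).ne', hk, Real.log_exp] at hfin
    have := mul_pos hε.1 (pow_pos hs0 2)
    linarith
  intro z hz
  rcases eq_or_ne z 0 with rfl | hz0
  · have := hball 0 (by simpa using hr₁)
    exact le_of_eq (by simpa using this)
  have hpos : 0 < ‖z‖ := norm_pos_iff.2 hz0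
  have hlim : Tendsto (fun ε : ℝ => Real.exp (ε + (2 - ε) * Real.log ‖z‖ - ε * ‖z‖ ^ 2)) (𝓝[>] 0)
      (𝓝 (‖z‖ ^ 2)) := by
    have hc : Continuous fun ε : ℝ => Real.exp (ε + (2 - ε) * Real.log ‖z‖ - ε * ‖z‖ ^ 2) := by
      fun_prop
    have hval : Real.exp (0 + (2 - 0) * Real.log ‖z‖ - 0 * ‖z‖ ^ 2) = ‖z‖ ^ 2 := by
      rw [← Real.exp_log (pow_pos hpos 2), Real.log_pow]
      simp
    have := hc.tendsto 0
    rw [hval] at this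
    exact this.mono_left nhdsWithin_le_nhds
  refine ge_of_tendsto hlim ?_
  filter_upwards [Ioo_mem_nhdsGT (zero_lt_one (α := ℝ))] with ε hε
  exact hmain ε hε z hz hz0

end InvMetric

/-! ### Second derivatives and the complex Hessian -/

/-- The necessary second order condition at a local minimum. -/
theorem IsLocalMin.deriv_deriv_nonneg {k : ℝ → ℝ} {t : ℝ} (h : IsLocalMin k t)
    (hc : ContinuousAt k t) : 0 ≤ deriv (deriv k) t := by
  by_contra! hlt
  have hmax := isLocalMax_of_deriv_deriv_neg hlt h.deriv_eq_zero hc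
  have heq : k =ᶠ[𝓝 t] fun _ => k t := by
    filter_upwards [h, hmax] with s h₁ h₂ using le_antisymm h₂ h₁
  have : deriv (deriv k) t = 0 := by
    rw [heq.deriv.deriv_eq]
    simp
  linarith

section

variable {E : Type*} [NormedAddCommGroup E] [NormedSpace ℝ E] {u : E → ℝ} {p : E}

theorem ContDiffAt.eventually_hasDerivAt_line (hu : ContDiffAt ℝ 2 u p) (v : E) :
    ∀ᶠ t : ℝ in 𝓝 0, HasDerivAt (fun t : ℝ => u (p + t • v)) (fderiv ℝ u (p + t • v) v) t := by
  have hcont : Tendsto (fun t : ℝ => p + t • v) (𝓝 0) (𝓝 p) := by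
    have : Continuous fun t : ℝ => p + t • v := by fun_prop
    simpa using this.tendsto 0
  have hdiff : ∀ᶠ w in 𝓝 p, DifferentiableAt ℝ u w :=
    (hu.eventually (by simp)).mono fun w hw => hw.differentiableAt (by simp)
  filter_upwards [hcont.eventually hdiff] with t ht
  have h₁ : HasDerivAt (fun t : ℝ => p + t • v) v t := by
    simpa using ((hasDerivAt_id t).smul_const v).const_add p
  exact ht.hasFDerivAt.comp_hasDerivAt t h₁

theorem ContDiffAt.deriv_deriv_line_sub_sq (hu : ContDiffAt ℝ 2 u p) (v : E) (c : ℝ) :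
    deriv (deriv fun t : ℝ => u (p + t • v) - c * t ^ 2) 0
      = fderiv ℝ (fderiv ℝ u) p v v - 2 * c := by
  have heq : (deriv fun t : ℝ => u (p + t • v) - c * t ^ 2)
      =ᶠ[𝓝 0] fun t => fderiv ℝ u (p + t • v) v - 2 * c * t := by
    filter_upwards [hu.eventually_hasDerivAt_line v] with t ht
    refine (ht.sub (((hasDerivAt_id t).pow 2).const_mul c)).deriv.trans ?_
    simp
    ring
  rw [heq.deriv_eq]
  have hd : HasFDerivAt (fderiv ℝ u) (fderiv ℝ (fderiv ℝ u) p) (p + (0 : ℝ) • v) := by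
    simpa using ((hu.fderiv_right (m := 1) (by norm_num)).differentiableAt
      (by simp)).hasFDerivAt
  have h₁ : HasDerivAt (fun t : ℝ => p + t • v) v 0 := by
    simpa using ((hasDerivAt_id (0 : ℝ)).smul_const v).const_add p
  have h₂ : HasDerivAt (fun t : ℝ => fderiv ℝ u (p + t • v) v)
      (fderiv ℝ (fderiv ℝ u) p v v) 0 := by
    exact ((ContinuousLinearMap.apply ℝ ℝ v).hasFDerivAt).comp_hasDerivAt 0
      (hd.comp_hasDerivAt 0 h₁)
  refine (h₂.sub ((hasDerivAt_id (0 : ℝ)).const_mul (2 * c))).deriv.trans ?_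
  simp

theorem ContDiffAt.le_fderiv_fderiv (hu : ContDiffAt ℝ 2 u p) (hp : u p = 0) {v : E} {c : ℝ}
    (h : ∀ᶠ t : ℝ in 𝓝 0, c * t ^ 2 ≤ u (p + t • v)) :
    2 * c ≤ fderiv ℝ (fderiv ℝ u) p v v := by
  have hmin : IsLocalMin (fun t : ℝ => u (p + t • v) - c * t ^ 2) 0 := by
    filter_upwards [h] with t ht
    simpa [hp] using ht
  have hc : ContinuousAt (fun t : ℝ => u (p + t • v) - c * t ^ 2) 0 :=
    (hu.eventually_hasDerivAt_line v).self_of_nhds.continuousAt.sub (by fun_prop)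
  have := hmin.deriv_deriv_nonneg hc
  rw [hu.deriv_deriv_line_sub_sq] at this
  linarith

theorem ContDiffAt.fderiv_fderiv_le (hu : ContDiffAt ℝ 2 u p) (hp : u p = 0) {v : E} {c : ℝ}
    (h : ∀ᶠ t : ℝ in 𝓝 0, u (p + t • v) ≤ c * t ^ 2) :
    fderiv ℝ (fderiv ℝ u) p v v ≤ 2 * c := by
  have := hu.neg.le_fderiv_fderiv (p := p) (by simp [hp]) (v := v) (c := -c)
    (h.mono fun t ht => by simpa using ht)
  have h₂ : (fderiv ℝ fun x => -u x) = fun x => -fderiv ℝ u x := by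
    ext1 x; exact fderiv_fun_neg
  rw [h₂, fderiv_fun_neg] at this
  simp only [_root_.neg_apply] at this
  linarith

/-- A nonnegative `C²` function vanishing at a point vanishes there to second order. -/
theorem ContDiffAt.isBigO_sq_of_nonneg (hu : ContDiffAt ℝ 2 u p) (hp : u p = 0)
    (h : ∀ᶠ x in 𝓝 p, 0 ≤ u x) : u =O[𝓝 p] fun x => ‖x - p‖ ^ 2 := by
  have hmin : IsLocalMin u p := h.mono fun x hx => by rwa [hp]
  have hD : fderiv ℝ u =O[𝓝 p] fun x => x - p := by
    have := ((hu.fderiv_right (m := 1) (by norm_num)).differentiableAt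
      (by simp)).hasFDerivAt.isBigO_sub
    simpa [hmin.fderiv_eq_zero] using this
  obtain ⟨C, hC0, hC⟩ := hD.exists_nonneg
  have hdiff : ∀ᶠ w in 𝓝 p, DifferentiableAt ℝ u w :=
    (hu.eventually (by simp)).mono fun w hw => hw.differentiableAt (by simp)
  obtain ⟨r, hr, hball⟩ := Metric.eventually_nhds_iff_ball.1 (hC.bound.and hdiff)
  refine Asymptotics.IsBigO.of_bound C ?_
  filter_upwards [Metric.ball_mem_nhds p hr] with x hx
  have hseg : segment ℝ p x ⊆ Metric.closedBall p ‖x - p‖ :=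
    (convex_closedBall p ‖x - p‖).segment_subset (by simp) (by simp [dist_eq_norm])
  have hx' : ‖x - p‖ < r := by simpa [dist_eq_norm] using hx
  have hsub : ∀ y ∈ segment ℝ p x, y ∈ Metric.ball p r := fun y hy =>
    lt_of_le_of_lt (hseg hy) hx'
  have hmv := (convex_segment p x).norm_image_sub_le_of_norm_fderiv_le (𝕜 := ℝ) (f := u)
    (C := C * ‖x - p‖) (fun y hy => (hball y (hsub y hy)).2) (fun y hy => ?_)
    (left_mem_segment ℝ p x) (right_mem_segment ℝ p x)
  · simpa [hp, pow_two, mul_assoc] using hmv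
  · refine (hball y (hsub y hy)).1.trans ?_
    have : ‖y - p‖ ≤ ‖x - p‖ := by simpa [dist_eq_norm] using hseg hy
    gcongr

end

namespace InvMetric

variable {n : ℕ} {Ω : Set (Cn n)} {P Q ξ : Cn n} {u : Cn n → ℝ}

/-- Twice the complex linear part of a real linear functional, in coordinates. -/
theorem sum_wirtinger (L : Cn n →L[ℝ] ℝ) (ξ : Cn n) :
    ∑ i, ((L (EuclideanSpace.single i 1) : ℂ)
        - Complex.I * L (EuclideanSpace.single i Complex.I)) * ξ i
      = L ξ - Complex.I * L (Complex.I • ξ) := by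
  have hdecomp : ∀ η : Cn n, L η = ∑ i, ((η i).re * L (EuclideanSpace.single i 1)
      + (η i).im * L (EuclideanSpace.single i Complex.I)) := by
    intro η
    have : η = ∑ i, ((η i).re • EuclideanSpace.single i (1 : ℂ)
        + (η i).im • EuclideanSpace.single i Complex.I) := by
      ext j
      simp only [WithLp.ofLp_sum, Finset.sum_apply,
        WithLp.ofLp_add, WithLp.ofLp_smul, Pi.add_apply, Pi.smul_apply, PiLp.ofLp_single,
        Pi.single_apply, smul_ite, smul_zero]
      simp [Finset.sum_add_distrib, Complex.re_add_im]
    conv_lhs => rw [this]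
    simp [map_sum]
  rw [hdecomp ξ, hdecomp (Complex.I • ξ)]
  push_cast
  rw [Finset.mul_sum, ← Finset.sum_sub_distrib]
  refine Finset.sum_congr rfl fun i _ => ?_
  have h₁ : (Complex.I • ξ) i = Complex.I * ξ i := rfl
  rw [h₁]
  conv_lhs => rw [← Complex.re_add_im (ξ i)]
  simp only [Complex.mul_re, Complex.mul_im, Complex.I_re, Complex.I_im]
  push_cast
  ring_nf
  rw [Complex.I_sq]
  ring

/-- Twice the conjugate linear part of a real linear functional, in coordinates. -/
theorem sum_wirtinger_conj (L : Cn n →L[ℝ] ℝ) (ξ : Cn n) :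
    ∑ i, ((L (EuclideanSpace.single i 1) : ℂ)
        + Complex.I * L (EuclideanSpace.single i Complex.I)) * starRingEnd ℂ (ξ i)
      = L ξ + Complex.I * L (Complex.I • ξ) := by
  have := congrArg (starRingEnd ℂ) (sum_wirtinger L ξ)
  simpa [map_sum] using this

theorem dz_dzbar (hu : ContDiffAt ℝ 2 u P) (i j : Fin n) :
    dz i (dzbar j fun z => (u z : ℂ)) P =
      (((fderiv ℝ (fderiv ℝ u) P (EuclideanSpace.single i 1) (EuclideanSpace.single j 1) : ℂ)
        + Complex.I * fderiv ℝ (fderiv ℝ u) P (EuclideanSpace.single i 1)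
            (EuclideanSpace.single j Complex.I))
      - Complex.I * ((fderiv ℝ (fderiv ℝ u) P (EuclideanSpace.single i Complex.I)
            (EuclideanSpace.single j 1) : ℂ)
        + Complex.I * fderiv ℝ (fderiv ℝ u) P (EuclideanSpace.single i Complex.I)
            (EuclideanSpace.single j Complex.I))) / 4 := by
  have hdiff : ∀ᶠ w in 𝓝 P, DifferentiableAt ℝ u w :=
    (hu.eventually (by simp)).mono fun w hw => hw.differentiableAt (by simp)
  have hU : ∀ᶠ w in 𝓝 P, ∀ v, fderiv ℝ (fun z => (u z : ℂ)) w v = (fderiv ℝ u w v : ℂ) := by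
    filter_upwards [hdiff] with w hw v
    have := (Complex.ofRealCLM.hasFDerivAt (x := u w)).comp w hw.hasFDerivAt
    have h₂ : fderiv ℝ (fun z => (u z : ℂ)) w = Complex.ofRealCLM.comp (fderiv ℝ u w) := this.fderiv
    rw [h₂]; rfl
  have heq : dzbar j (fun z => (u z : ℂ)) =ᶠ[𝓝 P] fun w =>
      ((fderiv ℝ u w (EuclideanSpace.single j 1) : ℂ)
        + Complex.I * fderiv ℝ u w (EuclideanSpace.single j Complex.I)) / 2 := by
    filter_upwards [hU] with w hw
    rw [dzbar, hw, hw]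
  have hd : HasFDerivAt (fderiv ℝ u) (fderiv ℝ (fderiv ℝ u) P) P :=
    ((hu.fderiv_right (m := 1) (by norm_num)).differentiableAt (by simp)).hasFDerivAt
  have happ : ∀ v : Cn n, HasFDerivAt (fun w => (fderiv ℝ u w v : ℂ))
      (Complex.ofRealCLM.comp ((ContinuousLinearMap.apply ℝ ℝ v).comp
        (fderiv ℝ (fderiv ℝ u) P))) P := fun v =>
    (Complex.ofRealCLM.hasFDerivAt).comp P
      (((ContinuousLinearMap.apply ℝ ℝ v).hasFDerivAt).comp P hd)
  have hfin := ((happ (EuclideanSpace.single j 1)).add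
    ((happ (EuclideanSpace.single j Complex.I)).const_mul Complex.I)).mul_const ((2 : ℂ)⁻¹)
  have hF := (hfin.congr_of_eventuallyEq (heq.trans (Eventually.of_forall fun w => by
    simp [div_eq_mul_inv]))).fderiv
  rw [dz, hF]
  simp
  ring

/-- The complex Hessian is half the average of the second derivatives in the directions `ξ` and
`i ξ`. -/
theorem complexHessian_eq (hu : ContDiffAt ℝ 2 u P) (ξ : Cn n) :
    complexHessian u P ξ = (fderiv ℝ (fderiv ℝ u) P ξ ξ
      + fderiv ℝ (fderiv ℝ u) P (Complex.I • ξ) (Complex.I • ξ)) / 4 := by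
  set B := fderiv ℝ (fderiv ℝ u) P with hB
  have hinner : ∀ i, ∑ j, dz i (dzbar j fun z => (u z : ℂ)) P * ξ i * starRingEnd ℂ (ξ j)
      = (((B (EuclideanSpace.single i 1) ξ : ℂ)
          - Complex.I * B (EuclideanSpace.single i Complex.I) ξ) * ξ i
        + Complex.I * (((B (EuclideanSpace.single i 1) (Complex.I • ξ) : ℂ)
          - Complex.I * B (EuclideanSpace.single i Complex.I) (Complex.I • ξ)) * ξ i)) / 4 := by
    intro i
    have h₁ := sum_wirtinger_conj (B (EuclideanSpace.single i 1)) ξ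
    have h₂ := sum_wirtinger_conj (B (EuclideanSpace.single i Complex.I)) ξ
    have h₃ : ∀ j, dz i (dzbar j fun z => (u z : ℂ)) P * ξ i * starRingEnd ℂ (ξ j)
        = (ξ i / 4) * (((B (EuclideanSpace.single i 1) (EuclideanSpace.single j 1) : ℂ)
          + Complex.I * B (EuclideanSpace.single i 1) (EuclideanSpace.single j Complex.I))
            * starRingEnd ℂ (ξ j))
        - (ξ i / 4) * Complex.I * (((B (EuclideanSpace.single i Complex.I)
            (EuclideanSpace.single j 1) : ℂ)
          + Complex.I * B (EuclideanSpace.single i Complex.I)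
            (EuclideanSpace.single j Complex.I)) * starRingEnd ℂ (ξ j)) := by
      intro j
      rw [dz_dzbar hu]
      ring
    rw [Finset.sum_congr rfl fun j _ => h₃ j, Finset.sum_sub_distrib, ← Finset.mul_sum,
      ← Finset.mul_sum, h₁, h₂]
    ring
  have h₁ := sum_wirtinger (B.flip ξ) ξ
  have h₂ := sum_wirtinger (B.flip (Complex.I • ξ)) ξ
  simp only [ContinuousLinearMap.flip_apply] at h₁ h₂
  rw [complexHessian, Finset.sum_congr rfl fun i _ => hinner i, ← Finset.sum_div,
    Finset.sum_add_distrib, ← Finset.mul_sum, h₁, h₂]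
  simp

theorem complexHessian_le (hu : ContDiffAt ℝ 2 u P) (hP : u P = 0) {c : ℝ}
    (h : ∀ᶠ z : ℂ in 𝓝 0, u (P + z • ξ) ≤ c * ‖z‖ ^ 2) : complexHessian u P ξ ≤ c := by
  have hray : ∀ v : ℂ, ‖v‖ = 1 → fderiv ℝ (fderiv ℝ u) P (v • ξ) (v • ξ) ≤ 2 * c := by
    intro v hv
    refine hu.fderiv_fderiv_le hP ?_
    have ht : Tendsto (fun t : ℝ => (t : ℂ) * v) (𝓝 0) (𝓝 0) := by
      have : Continuous fun t : ℝ => (t : ℂ) * v := by fun_prop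
      simpa using this.tendsto 0
    filter_upwards [ht.eventually h] with t ht
    simpa [mul_smul, hv, Complex.coe_smul] using ht
  have h₁ := hray 1 (by simp)
  have h₂ := hray Complex.I (by simp)
  rw [one_smul] at h₁
  rw [complexHessian_eq hu]
  linarith

theorem le_complexHessian (hu : ContDiffAt ℝ 2 u P) (hP : u P = 0) {c : ℝ}
    (h : ∀ᶠ z : ℂ in 𝓝 0, c * ‖z‖ ^ 2 ≤ u (P + z • ξ)) : c ≤ complexHessian u P ξ := by
  have hray : ∀ v : ℂ, ‖v‖ = 1 → 2 * c ≤ fderiv ℝ (fderiv ℝ u) P (v • ξ) (v • ξ) := by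
    intro v hv
    refine hu.le_fderiv_fderiv hP ?_
    have ht : Tendsto (fun t : ℝ => (t : ℂ) * v) (𝓝 0) (𝓝 0) := by
      have : Continuous fun t : ℝ => (t : ℂ) * v := by fun_prop
      simpa using this.tendsto 0
    filter_upwards [ht.eventually h] with t ht
    simpa [mul_smul, hv, Complex.coe_smul] using ht
  have h₁ := hray 1 (by simp)
  have h₂ := hray Complex.I (by simp)
  rw [one_smul] at h₁
  rw [complexHessian_eq hu]
  linarith

end InvMetric

namespace InvMetric

variable {n : ℕ} {Ω : Set (Cn n)} {ρ : Cn n → ℝ} {P Q ξ : Cn n}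

/-! ### Comparison of the metrics -/

theorem tendsto_add_smul (Q ξ : Cn n) : Tendsto (fun z : ℂ => Q + z • ξ) (𝓝 0) (𝓝 Q) := by
  have : Continuous fun z : ℂ => Q + z • ξ := by fun_prop
  simpa using this.tendsto 0

/-- The affine disc is a competitor for the Kobayashi metric. -/
theorem kobayashi_le {r : ℝ} (hr : 0 < r) (h : ∀ z : ℂ, ‖z‖ ≤ r → Q + z • ξ ∈ Ω) :
    kobayashi Ω Q ξ ≤ ENNReal.ofReal (1 / r) := by
  refine iInf₂_le (1 / r) ⟨by positivity, fun z => Q + z • r • ξ, by fun_prop, ?_, by simp, ?_⟩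
  · intro z hz
    have hz1 : ‖z‖ < 1 := by simpa using hz
    have := h (z * r) (by
      rw [norm_mul, Complex.norm_real, Real.norm_of_nonneg hr.le]; nlinarith)
    rwa [mul_smul, Complex.coe_smul] at this
  · have : HasDerivAt (fun z : ℂ => Q + z • r • ξ) (r • ξ) 0 := by
      simpa using ((hasDerivAt_id (0 : ℂ)).smul_const (r • ξ)).const_add Q
    rw [this.deriv, one_div, inv_inv]

/-- The Schwarz lemma gives the comparison of the Carathéodory and the Kobayashi metrics. -/
theorem caratheodory_le_kobayashi (hΩ : IsOpen Ω) : caratheodory Ω Q ξ ≤ kobayashi Ω Q ξ := by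
  refine iSup₂_le fun f hf => le_iInf₂ fun α hα => ?_
  obtain ⟨hfd, hfm, hf0⟩ := hf
  obtain ⟨hα0, φ, hφd, hφm, hφ0, hφ'⟩ := hα
  refine ENNReal.ofReal_le_ofReal ?_
  have hQ : Q ∈ Ω := by
    rw [← hφ0]; exact hφm (by simp)
  have h₁ : HasFDerivAt f (fderiv ℂ f Q) (φ 0) := by
    rw [hφ0]; exact ((hfd Q hQ).differentiableAt (hΩ.mem_nhds hQ)).hasFDerivAt
  have h₂ : HasDerivAt φ (deriv φ 0) 0 :=
    ((hφd 0 (by simp)).differentiableAt (Metric.ball_mem_nhds 0 one_pos)).hasDerivAt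
  have hS := Complex.norm_deriv_le_one_of_mapsTo_ball (f := f ∘ φ) (hfd.comp hφd hφm)
    (fun z hz => by
      have : (f ∘ φ) 0 = 0 := by simp [hφ0, hf0]
      rw [this]
      exact Metric.ball_subset_closedBall (hfm (hφm hz))) one_pos
  rw [(h₁.comp_hasDerivAt 0 h₂).deriv, hφ', (fderiv ℂ f Q).map_smul_of_tower, norm_smul, norm_inv,
    Real.norm_of_nonneg hα0.le, inv_mul_le_iff₀ hα0, mul_one] at hS
  exact hS

/-- The affine disc bounds the Sibony metric from above: by the Schwarz lemma for logarithmically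
subharmonic functions, `u (Q + z ξ) ≤ |z|² / r²` for every candidate `u`. -/
theorem sibony_le {r : ℝ} (hΩ : IsOpen Ω) (hr : 0 < r) (h : ∀ z : ℂ, ‖z‖ ≤ r → Q + z • ξ ∈ Ω) :
    sibony Ω Q ξ ≤ ENNReal.ofReal (1 / r) := by
  refine iSup₂_le fun u hu => ENNReal.ofReal_le_ofReal ?_
  have hQ : Q ∈ Ω := by simpa using h 0 (by simpa using hr.le)
  set b : Cn n := r • ξ with hb
  have hdisc : ∀ z ∈ Metric.closedBall (0 : ℂ) 1, Q + z • b ∈ Ω := by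
    intro z hz
    have hz1 : ‖z‖ ≤ 1 := by simpa using hz
    have := h (z * r) (by
      rw [norm_mul, Complex.norm_real, Real.norm_of_nonneg hr.le]; nlinarith)
    rwa [mul_smul, Complex.coe_smul] at this
  have husc : UpperSemicontinuousOn (fun z : ℂ => u (Q + z • b)) (Metric.closedBall 0 1) := by
    intro z hz c hc
    have hc0 : 0 < c := lt_of_le_of_lt (hu.mem_Icc _ (hdisc z hz)).1 hc
    have hlt : ENNReal.log (ENNReal.ofReal (u (Q + z • b))) < ENNReal.log (ENNReal.ofReal c) :=
      ENNReal.log_lt_log ((ENNReal.ofReal_lt_ofReal_iff hc0).2 hc)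
    have hev := hu.log_psh.usc _ (hdisc z hz) _ hlt
    have hcont : Continuous fun z : ℂ => Q + z • b := by fun_prop
    have ht : Tendsto (fun z : ℂ => Q + z • b) (𝓝[Metric.closedBall 0 1] z)
        (𝓝[Ω] (Q + z • b)) :=
      hcont.continuousWithinAt.tendsto_nhdsWithin hdisc
    filter_upwards [ht.eventually hev] with w hw
    exact (ENNReal.ofReal_lt_ofReal_iff hc0).1 (ENNReal.log_lt_log_iff.1 hw)
  have hnn : ∀ᶠ w in 𝓝 Q, 0 ≤ u w := by
    filter_upwards [hΩ.mem_nhds hQ] with w hw using (hu.mem_Icc w hw).1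
  have hO : (fun z : ℂ => u (Q + z • b)) =O[𝓝 0] fun z => ‖z‖ ^ 2 := by
    refine ((hu.contDiffAt.isBigO_sq_of_nonneg hu.eq_zero hnn).comp_tendsto
      (tendsto_add_smul Q b)).trans ?_
    refine Asymptotics.IsBigO.of_bound (‖b‖ ^ 2) (Eventually.of_forall fun z => ?_)
    simp only [Function.comp_apply, add_sub_cancel_left, norm_smul, norm_pow, norm_mul, norm_norm]
    rw [mul_pow, mul_comm]
  have hS := le_norm_sq_of_log_subharmonic husc (fun z hz => (hu.mem_Icc _ (hdisc z hz)).2) hO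
    (fun z s hs hsub => by
      have hpt : ∀ w : ℂ, Q + z • b + w • ((s : ℂ) • b) = Q + (z + s * w) • b := by
        intro w; module
      have := hu.log_psh.le_circleMean (Q + z • b) ((s : ℂ) • b) (fun w hw => by
        rw [hpt]
        refine hdisc _ (hsub ?_)
        have hw1 : ‖w‖ ≤ 1 := by simpa using hw
        rw [mem_closedBall_iff_norm, add_sub_cancel_left, norm_mul, Complex.norm_real,
          Real.norm_of_nonneg hs.le]
        nlinarith)
      simpa only [hpt] using this)
  have hH : complexHessian u Q ξ ≤ (1 / r) ^ 2 := by
    refine complexHessian_le hu.contDiffAt hu.eq_zero ?_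
    filter_upwards [Metric.closedBall_mem_nhds (0 : ℂ) hr] with z hz
    have hzr : ‖z‖ ≤ r := by simpa using hz
    have hn : ‖z * (r : ℂ)⁻¹‖ = ‖z‖ / r := by
      rw [norm_mul, norm_inv, Complex.norm_real, Real.norm_of_nonneg hr.le, div_eq_mul_inv]
    have := hS (z * (r : ℂ)⁻¹) (by
      rw [mem_closedBall_zero_iff, hn]
      exact (div_le_one hr).2 hzr)
    have hpt : (z * (r : ℂ)⁻¹) • b = z • ξ := by
      rw [hb, ← Complex.coe_smul, smul_smul, mul_assoc,
        inv_mul_cancel₀ (by exact_mod_cast hr.ne'), mul_one]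
    rw [hpt, hn] at this
    calc u (Q + z • ξ) ≤ (‖z‖ / r) ^ 2 := this
      _ = (1 / r) ^ 2 * ‖z‖ ^ 2 := by ring
  calc Real.sqrt (complexHessian u Q ξ) ≤ Real.sqrt ((1 / r) ^ 2) := Real.sqrt_le_sqrt hH
    _ = 1 / r := Real.sqrt_sq (by positivity)

/-- For a holomorphic map `f` of `Ω` to the disc with `f Q = 0`, the function `|f|²` is a
candidate for the Sibony metric. -/
theorem isSibonyCandidate_norm_sq (hΩ : IsOpen Ω) {f : Cn n → ℂ}
    (hf : DifferentiableOn ℂ f Ω) (hf2 : ContDiffAt ℝ 2 f Q) (hfm : MapsTo f Ω (Metric.ball 0 1))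
    (hf0 : f Q = 0) : IsSibonyCandidate Ω Q fun z => ‖f z‖ ^ 2 where
  contDiffAt := hf2.norm_sq ℝ
  eq_zero := by simp [hf0]
  mem_Icc z hz := by
    have : ‖f z‖ < 1 := by simpa using hfm hz
    exact ⟨by positivity, pow_le_one₀ (norm_nonneg _) this.le⟩
  log_psh :=
    { usc := by
        refine ContinuousOn.upperSemicontinuousOn ?_
        exact ENNReal.continuous_log.comp_continuousOn
          (ENNReal.continuous_ofReal.comp_continuousOn (hf.continuousOn.norm.pow 2))
      ne_top := fun z _ => by simp
      le_circleMean := fun a b hab => by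
        have hcont : Continuous fun z : ℂ => a + z • b := by fun_prop
        have hopen : IsOpen {z : ℂ | a + z • b ∈ Ω} := hΩ.preimage hcont
        have hd : DifferentiableOn ℂ (fun z : ℂ => f (a + z • b)) {z : ℂ | a + z • b ∈ Ω} :=
          hf.comp (by fun_prop) fun z hz => hz
        have := log_norm_sq_le_circleMean ((hd.analyticOnNhd hopen).mono hab)
        simpa using this }

theorem norm_fderiv_le_sibony (hΩ : IsOpen Ω) (hQ : Q ∈ Ω) {f : Cn n → ℂ}
    (hf : DifferentiableOn ℂ f Ω) (hf2 : ContDiffAt ℝ 2 f Q) (hfm : MapsTo f Ω (Metric.ball 0 1))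
    (hf0 : f Q = 0) : ENNReal.ofReal ‖fderiv ℂ f Q ξ‖ ≤ sibony Ω Q ξ := by
  have hcand := isSibonyCandidate_norm_sq hΩ hf hf2 hfm hf0
  refine le_iSup₂_of_le _ hcand (ENNReal.ofReal_le_ofReal ?_)
  set l := fderiv ℂ f Q ξ with hl
  refine le_of_forall_pos_le_add fun ε hε => ?_
  rcases le_or_gt ‖l‖ ε with hle | hlt
  · have := Real.sqrt_nonneg (complexHessian (fun z => ‖f z‖ ^ 2) Q ξ)
    linarith
  have hder : HasDerivAt (fun z : ℂ => f (Q + z • ξ)) l 0 := by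
    have h₁ : HasDerivAt (fun z : ℂ => Q + z • ξ) ξ 0 := by
      simpa using ((hasDerivAt_id (0 : ℂ)).smul_const ξ).const_add Q
    have h₂ : HasFDerivAt f (fderiv ℂ f Q) (Q + (0 : ℂ) • ξ) := by
      simpa using ((hf Q hQ).differentiableAt (hΩ.mem_nhds hQ)).hasFDerivAt
    exact h₂.comp_hasDerivAt 0 h₁
  have hH : (‖l‖ - ε) ^ 2 ≤ complexHessian (fun z => ‖f z‖ ^ 2) Q ξ := by
    refine le_complexHessian hcand.contDiffAt hcand.eq_zero ?_
    filter_upwards [(hasDerivAt_iff_isLittleO.1 hder).def hε] with z hz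
    simp only [zero_smul, add_zero, hf0, sub_zero, smul_eq_mul] at hz
    have h₁ : ‖z * l‖ ≤ ‖f (Q + z • ξ)‖ + ‖f (Q + z • ξ) - z * l‖ := by
      rw [norm_sub_rev]; exact norm_le_norm_add_norm_sub' _ _
    rw [norm_mul] at h₁
    have h₂ : (‖l‖ - ε) * ‖z‖ ≤ ‖f (Q + z • ξ)‖ := by nlinarith
    rw [← mul_pow]
    exact pow_le_pow_left₀ (mul_nonneg (by linarith) (norm_nonneg z)) h₂ 2
  have := Real.le_sqrt_of_sq_le hH
  linarith

/-- If the complex line through `Q` in direction `ξ` leaves the convex domain `Ω` at distance `|z|`,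
the supporting hyperplane at the exit point and a Cayley transform give a holomorphic map of `Ω` to
the disc vanishing at `Q` with derivative at least `1 / (2 |z|)` in direction `ξ`. -/
theorem exists_holomorphic_of_notMem (hΩ : IsOpen Ω) (hconv : Convex ℝ Ω) (hQ : Q ∈ Ω) {z : ℂ}
    (hz : Q + z • ξ ∉ Ω) :
    ∃ f : Cn n → ℂ, DifferentiableOn ℂ f Ω ∧ ContDiffAt ℝ 2 f Q ∧
      MapsTo f Ω (Metric.ball 0 1) ∧ f Q = 0 ∧ 1 / (2 * ‖z‖) ≤ ‖fderiv ℂ f Q ξ‖ := by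
  obtain ⟨L, hL⟩ : ∃ L : Cn n →L[ℂ] ℂ, ∀ w ∈ Ω, (L w).re < (L (Q + z • ξ)).re :=
    RCLike.geometric_hahn_banach_open_point (𝕜 := ℂ) hconv hΩ hz
  set p := Q + z • ξ with hp
  set q : ℂ := L Q - L p with hq
  have hneg : ∀ w ∈ Ω, (L w - L p).re < 0 := fun w hw => by
    rw [Complex.sub_re]; linarith [hL w hw]
  have hqre : q.re < 0 := hneg Q hQ
  have hqz : q = -(z * L ξ) := by
    rw [hq, hp, map_add, map_smul, smul_eq_mul]; ring
  have hden : ∀ w ∈ Ω, L w - L p + starRingEnd ℂ q ≠ 0 := by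
    intro w hw h0
    have := congrArg Complex.re h0
    rw [Complex.add_re, Complex.conj_re, Complex.zero_re] at this
    linarith [hneg w hw]
  set f : Cn n → ℂ := fun w => (L w - L p - q) * (L w - L p + starRingEnd ℂ q)⁻¹ with hf
  have hd : DifferentiableOn ℂ f Ω := by
    have h₁ : DifferentiableOn ℂ (fun w => L w - L p + starRingEnd ℂ q) Ω := by fun_prop
    exact DifferentiableOn.mul (by fun_prop) (h₁.fun_inv hden)
  have hderiv : HasFDerivAt f ((q + starRingEnd ℂ q)⁻¹ • L) Q := by
    have h₁ : HasFDerivAt (fun w => L w - L p - q) L Q := (L.hasFDerivAt.sub_const _).sub_const _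
    have h₂ : HasFDerivAt (fun w => L w - L p + starRingEnd ℂ q) L Q :=
      (L.hasFDerivAt.sub_const _).add_const _
    have h₃ := h₁.mul ((hasDerivAt_inv (hden Q hQ)).comp_hasFDerivAt Q h₂)
    refine h₃.congr_fderiv (ContinuousLinearMap.ext fun v => ?_)
    change (L Q - L p - q) * _ + (L Q - L p + starRingEnd ℂ q)⁻¹ * L v
      = (q + starRingEnd ℂ q)⁻¹ * L v
    rw [← hq, sub_self, zero_mul, zero_add]
  refine ⟨f, hd, ?_, ?_, by simp [hf, hq], ?_⟩
  · have : ContDiffAt ℂ 2 f Q := by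
      refine ContDiffAt.mul ?_ (ContDiffAt.inv ?_ (hden Q hQ))
      · exact ((L.contDiff.contDiffAt).sub contDiffAt_const).sub contDiffAt_const
      · exact ((L.contDiff.contDiffAt).sub contDiffAt_const).add contDiffAt_const
    exact this.restrict_scalars ℝ
  · intro w hw
    rw [mem_ball_zero_iff]
    change ‖(L w - L p - q) * (L w - L p + starRingEnd ℂ q)⁻¹‖ < 1
    rw [norm_mul, norm_inv, ← div_eq_mul_inv, div_lt_one (norm_pos_iff.2 (hden w hw)),
      ← pow_lt_pow_iff_left₀ (norm_nonneg _) (norm_nonneg _) two_ne_zero,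
      ← Complex.normSq_eq_norm_sq, ← Complex.normSq_eq_norm_sq]
    set a := L w - L p with ha
    have := mul_pos_of_neg_of_neg (hneg w hw) hqre
    rw [Complex.normSq_apply, Complex.normSq_apply]
    simp only [Complex.sub_re, Complex.sub_im, Complex.add_re, Complex.add_im, Complex.conj_re,
      Complex.conj_im]
    nlinarith
  · have hz0 : 0 < ‖z‖ := by
      rw [norm_pos_iff]
      rintro rfl
      rw [hqz] at hqre
      simp at hqre
    have hs : q + starRingEnd ℂ q = ((2 * q.re : ℝ) : ℂ) := Complex.add_conj q
    rw [hderiv.fderiv, _root_.smul_apply, smul_eq_mul, norm_mul, norm_inv, hs, Complex.norm_real,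
      Real.norm_eq_abs, abs_mul, abs_two]
    have hqn : |q.re| ≤ ‖z‖ * ‖L ξ‖ := by
      rw [← norm_mul, ← norm_neg, ← hqz]
      exact Complex.abs_re_le_norm q
    have hq0 : 0 < |q.re| := abs_pos.2 hqre.ne
    rw [inv_mul_eq_div, div_le_div_iff₀ (by positivity) (by positivity)]
    nlinarith

/-- `F` is one of the three invariant metrics of `Ω`. -/
def IsInvariantMetric (Ω : Set (Cn n)) (F : Cn n → Cn n → ℝ≥0∞) : Prop :=
  F = kobayashi Ω ∨ F = sibony Ω ∨ F = caratheodory Ω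

theorem IsInvariantMetric.le_of_disc {F : Cn n → Cn n → ℝ≥0∞} (hF : IsInvariantMetric Ω F)
    (hΩ : IsOpen Ω) {r : ℝ} (hr : 0 < r) (h : ∀ z : ℂ, ‖z‖ ≤ r → Q + z • ξ ∈ Ω) :
    F Q ξ ≤ ENNReal.ofReal (1 / r) := by
  rcases hF with rfl | rfl | rfl
  · exact kobayashi_le hr h
  · exact sibony_le hΩ hr h
  · exact (caratheodory_le_kobayashi hΩ).trans (kobayashi_le hr h)

theorem IsInvariantMetric.le_of_notMem {F : Cn n → Cn n → ℝ≥0∞} (hF : IsInvariantMetric Ω F)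
    (hΩ : IsOpen Ω) (hconv : Convex ℝ Ω) (hQ : Q ∈ Ω) {z : ℂ} (hz : Q + z • ξ ∉ Ω) :
    ENNReal.ofReal (1 / (2 * ‖z‖)) ≤ F Q ξ := by
  obtain ⟨f, hfd, hf2, hfm, hf0, hle⟩ := exists_holomorphic_of_notMem hΩ hconv hQ hz
  have hC : ENNReal.ofReal ‖fderiv ℂ f Q ξ‖ ≤ caratheodory Ω Q ξ :=
    le_iSup₂ (f := fun (f : Cn n → ℂ) (_ : DifferentiableOn ℂ f Ω ∧
      MapsTo f Ω (Metric.ball 0 1) ∧ f Q = 0) => ENNReal.ofReal ‖fderiv ℂ f Q ξ‖) f ⟨hfd, hfm, hf0⟩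
  refine (ENNReal.ofReal_le_ofReal hle).trans ?_
  rcases hF with rfl | rfl | rfl
  · exact hC.trans (caratheodory_le_kobayashi hΩ)
  · exact norm_fderiv_le_sibony hΩ hQ hfd hf2 hfm hf0
  · exact hC

/-- The two-sided estimate of the metric at `P - δ ν`, from the inner disc and the exit point of
its complex line in direction `ξ`, both of size `δ ^ (1 / m)`. -/
theorem IsInvariantMetric.estimate {F : Cn n → Cn n → ℝ≥0∞} (hF : IsInvariantMetric Ω F)
    (h : IsSmoothlyBounded Ω ρ) (hconv : Convex ℝ Ω) (hP : P ∈ frontier Ω) (hξ : ξ ≠ 0) {m : ℕ}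
    (hm : m ≠ 0) (hO : (fun z : ℂ => ρ (P + z • ξ)) =O[𝓝 0] fun z => ‖z‖ ^ m)
    {a : ℝ} (ha : 0 < a) {v : ℂ} (hv : ∀ᶠ t : ℝ in 𝓝[>] 0, a * t ^ m ≤ ρ (P + (t • v) • ξ)) :
    ∃ c > (0 : ℝ), ∃ C > (0 : ℝ), ∀ᶠ δ : ℝ in 𝓝[>] 0,
      ENNReal.ofReal (c * (‖ξ‖ / δ ^ (1 / (m : ℝ)))) ≤ F (P - δ • unitNormal ρ P) ξ ∧
      F (P - δ • unitNormal ρ P) ξ ≤ ENNReal.ofReal (C * (‖ξ‖ / δ ^ (1 / (m : ℝ)))) := by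
  obtain ⟨r, hr, hdisc⟩ := h.exists_disc_subset hP hm hO
  obtain ⟨K, hK, hexit⟩ := h.exists_notMem hP hm ha hv
  have hξ0 : 0 < ‖ξ‖ := norm_pos_iff.2 hξ
  refine ⟨1 / (2 * K * ‖ξ‖), by positivity, 1 / (r * ‖ξ‖), by positivity, ?_⟩
  filter_upwards [hdisc, hexit, self_mem_nhdsWithin] with δ hδd ⟨z, hz, hzΩ⟩ hδ
  have hpow : 0 < δ ^ (1 / (m : ℝ)) := Real.rpow_pos_of_pos hδ _
  have hQ : P - δ • unitNormal ρ P ∈ Ω := by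
    simpa using hδd 0 (by rw [norm_zero]; positivity)
  have hz0 : 0 < ‖z‖ := by
    rw [norm_pos_iff]
    rintro rfl
    exact hzΩ (by simpa using hQ)
  constructor
  · refine (ENNReal.ofReal_le_ofReal ?_).trans (hF.le_of_notMem h.isOpen hconv hQ hzΩ)
    calc 1 / (2 * K * ‖ξ‖) * (‖ξ‖ / δ ^ (1 / (m : ℝ))) = 1 / (2 * (K * δ ^ (1 / (m : ℝ)))) := by
          field_simp
      _ ≤ 1 / (2 * ‖z‖) := by gcongr
  · refine (hF.le_of_disc h.isOpen (by positivity) hδd).trans_eq ?_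
    congr 1
    field_simp

end InvMetric

theorem theorem1 {n : ℕ} (Ω : Set (InvMetric.Cn n)) (ρ : InvMetric.Cn n → ℝ)
    (hΩ : InvMetric.IsSmoothlyBounded Ω ρ) (hconv : Convex ℝ Ω)
    (hfin : InvMetric.IsFiniteType Ω ρ)
    (P : InvMetric.Cn n) (hP : P ∈ frontier Ω)
    (F : InvMetric.Cn n → InvMetric.Cn n → ℝ≥0∞)
    (hF : F = InvMetric.kobayashi Ω ∨ F = InvMetric.sibony Ω ∨ F = InvMetric.caratheodory Ω) :
    (∀ᶠ δ : ℝ in 𝓝[>] 0, P - δ • InvMetric.unitNormal ρ P ∈ Ω) ∧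
    (∀ ξ ∈ InvMetric.complexTangentSpace ρ P, ξ ≠ 0 →
      ∃ m : ℕ, InvMetric.tangencyOrder ρ P ξ = m ∧
        ∃ c > (0 : ℝ), ∃ C > (0 : ℝ), ∀ᶠ δ : ℝ in 𝓝[>] 0,
          ENNReal.ofReal (c * (‖ξ‖ / δ ^ (1 / (m : ℝ))))
              ≤ F (P - δ • InvMetric.unitNormal ρ P) ξ ∧
          F (P - δ • InvMetric.unitNormal ρ P) ξ
              ≤ ENNReal.ofReal (C * (‖ξ‖ / δ ^ (1 / (m : ℝ))))) ∧
    (∃ c > (0 : ℝ), ∃ C > (0 : ℝ), ∀ᶠ δ : ℝ in 𝓝[>] 0,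
      ENNReal.ofReal (c * (1 / δ))
          ≤ F (P - δ • InvMetric.unitNormal ρ P) (InvMetric.unitNormal ρ P) ∧
      F (P - δ • InvMetric.unitNormal ρ P) (InvMetric.unitNormal ρ P)
          ≤ ENNReal.ofReal (C * (1 / δ))) := by
  have hF' : InvMetric.IsInvariantMetric Ω F := hF
  have hρ0 := hΩ.eq_zero_of_mem_frontier hP
  have hzero : ∀ ξ : InvMetric.Cn n,
      iteratedFDeriv ℝ 0 (fun z : ℂ => ρ (P + z • ξ)) 0 = 0 := fun ξ => by
    rw [← norm_eq_zero, norm_iteratedFDeriv_zero]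
    simp [hρ0]
  set ν := InvMetric.unitNormal ρ P with hν
  have hν1 : ‖ν‖ = 1 := by
    rw [hν, InvMetric.unitNormal, norm_smul, norm_inv, norm_norm]
    exact inv_mul_cancel₀ (norm_ne_zero_iff.2 (hΩ.gradient_ne_zero P hP))
  -- In the normal direction `ρ` vanishes exactly to first order.
  have hνO : (fun z : ℂ => ρ (P + z • ν)) =O[𝓝 0] fun z => ‖z‖ ^ 1 :=
    (hΩ.contDiff_line P ν).isBigO_norm_pow_of_iteratedFDeriv_eq_zero fun k hk => by
      obtain rfl : k = 0 := by omega
      exact hzero ν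
  refine ⟨?_, fun ξ hξ hξ0 => ?_, ?_⟩
  · obtain ⟨c, hc, hdisc⟩ := hΩ.exists_disc_subset hP one_ne_zero hνO
    filter_upwards [hdisc, self_mem_nhdsWithin] with δ hδ hδ0
    have hδ0 : 0 < δ := hδ0
    simpa using hδ 0 (by rw [norm_zero]; positivity)
  · obtain ⟨m, hm⟩ := ENat.ne_top_iff_exists.1 ((hfin P hP).tangencyOrder_ne_top hξ0)
    refine ⟨m, hm.symm, ?_⟩
    obtain ⟨hne, hlow⟩ := InvMetric.vanishingOrder_eq_coe hm.symm
    have hm0 : m ≠ 0 := by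
      rintro rfl
      exact hne (hzero ξ)
    obtain ⟨a, ha, v, hv⟩ := hΩ.exists_growth hconv hP hξ hm.symm
    exact hF'.estimate hΩ hconv hP hξ0 hm0
      ((hΩ.contDiff_line P ξ).isBigO_norm_pow_of_iteratedFDeriv_eq_zero hlow) ha hv
  · have hG := hΩ.fderiv_unitNormal_pos hP
    have hder : HasDerivAt (fun t : ℝ => ρ (P + t • ν)) (fderiv ℝ ρ P ν) 0 := by
      have h₁ : HasDerivAt (fun t : ℝ => P + t • ν) ν 0 := by
        simpa using ((hasDerivAt_id (0 : ℝ)).smul_const ν).const_add P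
      have h₂ : HasFDerivAt ρ (fderiv ℝ ρ P) (P + (0 : ℝ) • ν) := by
        simpa using (hΩ.smooth.differentiable (by simp) P).hasFDerivAt
      exact h₂.comp_hasDerivAt 0 h₁
    have hgrow : ∀ᶠ t : ℝ in 𝓝[>] 0,
        fderiv ℝ ρ P ν / 2 * t ^ 1 ≤ ρ (P + (t • (1 : ℂ)) • ν) := by
      filter_upwards [nhdsWithin_le_nhds ((hasDerivAt_iff_isLittleO.1 hder).def (half_pos hG)),
        self_mem_nhdsWithin] with t ht ht0
      have ht0 : 0 < t := ht0
      simp only [sub_zero, zero_smul, add_zero, hρ0, smul_eq_mul, Real.norm_eq_abs,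
        abs_of_pos ht0] at ht
      have hpt : (t • (1 : ℂ)) • ν = t • ν := by rw [smul_assoc, one_smul]
      rw [hpt, pow_one]
      linarith [(abs_le.1 ht).1]
    have hν0 : ν ≠ 0 := norm_ne_zero_iff.1 (by rw [hν1]; exact one_ne_zero)
    simpa [hν1] using hF'.estimate hΩ hconv hP hν0 one_ne_zero hνO (half_pos hG) hgrow
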